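/- Let $p$ be a prime, $K$ a field of characteristic $p$, and $G$ a cyclic group of order $p^r$ with generator $\sigma$. Let $V$ be a finite-dimensional $KG$-module and write $V=\bigoplus_{i=0}^k V_{n_i}$ with $n_i\ge 1$, where $V_{n_i}$ has a basis $e_{1,i},\dots,e_{n_i,i}$ with $\sigma^{-1}(e_{j,i})=e_{j,i}+e_{j+1,i}$ for $1\le j<n_i$ and $\sigma^{-1}(e_{n_i,i})=e_{n_i,i}$ (such a decomposition always exists, and $n_i\le p^r$). Let $G$ act on $K[V]=S(V^*)$ by algebra automorphisms extending its action $g\cdot \ell=\ell\circ g^{-1}$ on $V^*$, let $\mathcal H=K[V]^G_+K[V]$ be the Hilbert ideal, generated by the invariants with zero constant term, and let $K[V]_G=K[V]/\mathcal H$ be the algebra of coinvariants. A member of a basis of $V^*$ is called a terminal variable if the other members of the basis span a $G$-submodule of $V^*$. Let $x_0,\dots,x_k$ be members of a basis of $V^*$ such that, for each $i$, $x_i$ is a terminal variable and comes from the $i$-th summand, that is, $x_i$ vanishes on $V_{n_{i'}}$ for all $i'\neq i$. (For instance, in the basis $(x_{j,i})$ of $V^*$ dual to $(e_{j,i})$,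 take $x_i=x_{n_i,i}$.) Let $X_i$ be the image of $x_i$ in $K[V]_G$, and let $K[X_0,\dots,X_k]$ be the subalgebra of $K[V]_G$ generated by $X_0,\dots,X_k$. For each $i$ let $a_i$ be the largest integer with $n_i>p^{a_i-1}$. Then there is an isomorphism of $K$-algebras $$K[X_0,\dots,X_k]\;\cong\; K[t_0,\dots,t_k]/(t_0^{p^{a_0}},\dots,t_k^{p^{a_k}}),\qquad X_i\mapsto t_i,$$ where $t_0,\dots,t_k$ are independent variables. Moreover, $K[V]_G$ is free as a module over $K[X_0,\dots,X_k]$. -/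

import Mathlib

namespace CyclicCoinvariants

noncomputable section

open Module

variable {K G V : Type*} [Field K] [Group G] [AddCommGroup V] [Module K V]

/-- The polynomial algebra `K[V] = S(V*)`. -/
abbrev PolyRing (K V : Type*) [Field K] [AddCommGroup V] [Module K V] : Type _ :=
  SymmetricAlgebra K (Dual K V)

/-- The algebra endomorphism of `K[V]` given by `g`, extending the contragredient action
`ℓ ↦ ℓ ∘ g⁻¹` on `V*`; as a polynomial function, `f` goes to `f ∘ g⁻¹`. -/
def polyAct (ρ : Representation K G V) (g : G) : PolyRing K V →ₐ[K] PolyRing K V :=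
  SymmetricAlgebra.lift (SymmetricAlgebra.ι K (Dual K V) ∘ₗ ρ.dual g)

/-- The Hilbert ideal of `K[V]`: it is generated by the invariants without constant term,
that is, by `K[V]^G_+`. -/
def hilbertIdeal (ρ : Representation K G V) : Ideal (PolyRing K V) :=
  Ideal.span {f | (∀ g : G, polyAct ρ g f = f) ∧ SymmetricAlgebra.algebraMapInv f = 0}

/-- The algebra of coinvariants `K[V]_G`, the quotient of `K[V]` by the Hilbert ideal. -/
abbrev Coinv (ρ : Representation K G V) : Type _ :=
  PolyRing K V ⧸ hilbertIdeal ρ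

/-- The image in `K[V]_G` of a linear form on `V`. -/
def linImage (ρ : Representation K G V) (l : Dual K V) : Coinv ρ :=
  Ideal.Quotient.mk (hilbertIdeal ρ) (SymmetricAlgebra.ι K (Dual K V) l)

/-- The subalgebra of `K[V]_G` generated by the images of the linear forms `y i`. -/
def linSubalgebra (ρ : Representation K G V) {I : Type*} (y : I → Dual K V) :
    Subalgebra K (Coinv ρ) :=
  Algebra.adjoin K (Set.range fun i => linImage ρ (y i))

/-- The image of `y i`, as an element of the subalgebra that these images generate. -/
def linGen (ρ : Representation K G V) {I : Type*} (y : I → Dual K V) (i : I) :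
    linSubalgebra ρ y :=
  ⟨linImage ρ (y i), Algebra.subset_adjoin ⟨i, rfl⟩⟩

/-- The member `x i` of a basis of `V*` is a terminal variable: the other members of the basis
span a `G`-stable subspace of `V*`. -/
def IsTerminal (ρ : Representation K G V) {I : Type*} (x : Basis I K (Dual K V)) (i : I) : Prop :=
  ∀ g : G, ∀ l ∈ Submodule.span K (x '' {j | j ≠ i}),
    ρ.dual g l ∈ Submodule.span K (x '' {j | j ≠ i})

/-- `e` is a basis of `V` in which `σ⁻¹` acts by Jordan blocks of sizes `n i` with eigenvalue `1`:
it maps `e_{j,i}` to `e_{j,i} + e_{j+1,i}`, and fixes the last basis vector of each block. -/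
def IsJordanBasis (ρ : Representation K G V) (σ : G) {I : Type*} {n : I → ℕ}
    (e : Basis (Σ i, Fin (n i)) K V) : Prop :=
  ∀ (i : I) (j : Fin (n i)),
    ρ σ⁻¹ (e ⟨i, j⟩) = e ⟨i, j⟩ + if h : j.1 + 1 < n i then e ⟨i, ⟨j.1 + 1, h⟩⟩ else 0

end

end CyclicCoinvariants

/-! Write g = σ⁻¹ and q_i = p^{a_i}, so that n_i ≤ q_i and p^b < n_i for b < a_i.

Nilpotency (`linImage_pow_eq_zero`): g^{q_i} fixes x_i, so ∏_{j<q_i} (T + x_i ∘ g^j) has invariant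
coefficients. Over the coinvariants it becomes T^{q_i}, and -X_i is a root.

Independence and freeness: the last vector of block i, rescaled to v_i, is fixed by G, and x_i(v_j)
= δ_ij. The Taylor coefficients of an invariant in the directions v_i are again invariants. Hence
translation by Σ b_i v_i descends to the coinvariants whenever b_i^{q_i} = 0
(`exists_coinv_translate`), provided that invariants restricted to the span of the v_i have no
nonconstant monomial with all exponents below q_i. Translating forward and back identifies K[V]_G
with the truncated polynomial algebra tensored with K[V]_G/(X_0, …, X_k).

The proviso is the heart (`coeff_pullback_eq_zero`). Binomial coefficients reduce it to this: an
invariant f has no t^{p^b} term on the line tv if gv = v and v = (g^{p^b} - 1)w. Here v is the sum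
of the g-orbit of gw - w. Pulling f back along this orbit gives a cyclically invariant polynomial in
p^b variables that the sum D of all partial derivatives kills. Its part of degree p^b vanishes at
(1, …, 1) by induction on b (`aeval_one_eq_zero_of_shift_invariant`), the step being
`exists_expand_eq_rename_fst`. -/

namespace CyclicCoinvariants

/-! ### Orbits of ℤ/p: single points or free -/

section PrimeOrbits

variable {p : ℕ} [Fact p.Prime] {X : Type*} [AddAction (ZMod p) X]

lemma one_vadd_eq_of_vadd_eq {k : ZMod p} (hk : k ≠ 0) {x : X} (h : k +ᵥ x = x) :
    (1 : ZMod p) +ᵥ x = x := by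
  have hn : ∀ n : ℕ, ((n : ZMod p) * k) +ᵥ x = x := by
    intro n
    induction n with
    | zero => simp
    | succ n ih => rw [Nat.cast_succ, add_mul, one_mul, add_vadd, h, ih]
  have := hn (k⁻¹).val
  rwa [ZMod.natCast_zmod_val, inv_mul_cancel₀ hk] at this

lemma vadd_eq_of_one_vadd_eq {x : X} (h : (1 : ZMod p) +ᵥ x = x) (k : ZMod p) : k +ᵥ x = x := by
  have hn : ∀ n : ℕ, (n : ZMod p) +ᵥ x = x := by
    intro n
    induction n with
    | zero => simp
    | succ n ih => rw [Nat.cast_succ, add_vadd, h, ih]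
  simpa using hn k.val

lemma injective_vadd_of_one_vadd_ne {x : X} (h : (1 : ZMod p) +ᵥ x ≠ x) :
    Function.Injective fun k : ZMod p => k +ᵥ x := by
  intro k l hkl
  by_contra hne
  refine h (one_vadd_eq_of_vadd_eq (k := -l + k) ?_ ?_)
  · intro h0
    exact hne (by rwa [neg_add_eq_zero, eq_comm] at h0)
  · have : k +ᵥ x = l +ᵥ x := hkl
    rw [add_vadd, this, neg_vadd_vadd]

lemma exists_orbit_representatives (p : ℕ) (X : Type*) [AddAction (ZMod p) X] :
    ∃ rep : X → X, (∀ (k : ZMod p) x, rep (k +ᵥ x) = rep x) ∧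
      ∀ x, ∃ k : ZMod p, k +ᵥ rep x = x := by
  let s := AddAction.orbitRel (ZMod p) X
  refine ⟨fun x => (Quotient.mk s x).out, fun k x => ?_, fun x => ?_⟩
  · have : Quotient.mk s (k +ᵥ x) = Quotient.mk s x := Quotient.sound ⟨k, rfl⟩
    simp only [this]
  · exact Setoid.symm' s (Quotient.mk_out (s := s) x)

/-- An orbit contributes its `g`-sum times the constant value of `L`. This sum is zero on free
orbits by `hg` and at fixed points by `hfix`. -/
lemma sum_smul_eq_zero_of_orbit_sums {K M : Type*} [Ring K] [AddCommGroup M] [Module K M]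
    (S : Finset X) (g : X → K) (L : X → M) (hS : ∀ x, x ∉ S → g x = 0)
    (hL : ∀ (k : ZMod p) x, L (k +ᵥ x) = L x)
    (hg : ∀ x, ∑ k : ZMod p, g (k +ᵥ x) = 0)
    (hfix : ∀ x, (1 : ZMod p) +ᵥ x = x → g x = 0) :
    ∑ x ∈ S, g x • L x = 0 := by
  classical
  obtain ⟨rep, hrep, hk⟩ := exists_orbit_representatives p X
  rw [← Finset.sum_fiberwise_of_maps_to (s := S) (t := S.image rep) (g := rep)
    (fun x hx => Finset.mem_image_of_mem _ hx)]
  refine Finset.sum_eq_zero fun r _ => ?_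
  have h1 : ∑ x ∈ S with rep x = r, g x • L x = (∑ x ∈ S with rep x = r, g x) • L r := by
    rw [Finset.sum_smul]
    refine Finset.sum_congr rfl fun x hx => ?_
    obtain ⟨k, hx'⟩ := hk x
    rw [Finset.mem_filter] at hx
    rw [hx.2] at hx'
    rw [← hL k r, hx']
  rw [h1]
  convert zero_smul K (L r)
  by_cases hr : (1 : ZMod p) +ᵥ r = r
  · refine Finset.sum_eq_zero fun x hx => ?_
    obtain ⟨k, hx'⟩ := hk x
    rw [Finset.mem_filter] at hx
    rw [hx.2, vadd_eq_of_one_vadd_eq hr] at hx'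
    rw [← hx', hfix r hr]
  · rw [← hg r, ← Finset.sum_image (s := Finset.univ) (g := fun k : ZMod p => k +ᵥ r) (f := g)
      (fun a _ b _ hab => injective_vadd_of_one_vadd_ne hr hab)]
    -- `rep` is idempotent, so the fibre over `r` is empty unless `rep r = r`.
    by_cases hrr : rep r = r
    · refine Finset.sum_subset ?_ ?_
      · intro x hx
        obtain ⟨k, hx'⟩ := hk x
        rw [Finset.mem_filter] at hx
        rw [hx.2] at hx'
        exact Finset.mem_image.2 ⟨k, Finset.mem_univ _, hx'⟩
      · intro x hx hxS
        obtain ⟨k, -, rfl⟩ := Finset.mem_image.1 hx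
        refine hS _ fun h => hxS (Finset.mem_filter.2 ⟨h, by rw [hrep, hrr]⟩)
    · rw [Finset.sum_image (fun a _ b _ hab => injective_vadd_of_one_vadd_ne hr hab), hg]
      refine Finset.sum_eq_zero fun x hx => ?_
      rw [Finset.mem_filter] at hx
      obtain ⟨k, hx'⟩ := hk x
      exfalso
      apply hrr
      have := hrep k (rep x)
      rw [hx', hx.2] at this
      exact this.symm

/-- Concentrating `f` on one representative of each free orbit writes it there as a trace. -/
lemma exists_orbit_section {K : Type*} [AddCommMonoid K] (f : X → K)
    (hf : ∀ (k : ZMod p) x, f (k +ᵥ x) = f x) :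
    ∃ m : X → K, (∀ x, m x = f x ∨ m x = 0) ∧
      (∀ x, (1 : ZMod p) +ᵥ x = x → ∑ k : ZMod p, m (k +ᵥ x) = 0) ∧
      ∀ x, (1 : ZMod p) +ᵥ x ≠ x → ∑ k : ZMod p, m (k +ᵥ x) = f x := by
  classical
  obtain ⟨rep, hrep, hk⟩ := exists_orbit_representatives p X
  have hfixed : ∀ (k : ZMod p) (x : X), (1 : ZMod p) +ᵥ (k +ᵥ x) = k +ᵥ x ↔
      (1 : ZMod p) +ᵥ x = x := by
    intro k x
    rw [vadd_vadd, add_comm, add_vadd, vadd_left_cancel_iff]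
  refine ⟨fun x => if rep x = x ∧ (1 : ZMod p) +ᵥ x ≠ x then f x else 0, fun x => ?_,
    fun x h => ?_, fun x h => ?_⟩
  · dsimp only
    split_ifs <;> simp
  · simp [hfixed, h]
  · obtain ⟨k, hx⟩ := hk x
    have hx' : -k +ᵥ x = rep x := by
      nth_rewrite 1 [← hx]
      rw [neg_vadd_vadd]
    dsimp only
    simp only [hrep, ne_eq, hfixed]
    rw [Finset.sum_eq_single (-k)]
    · rw [if_pos ⟨hx'.symm, h⟩, hf]
    · intro l _ hl
      rw [if_neg]
      rintro ⟨h1, -⟩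
      exact hl (injective_vadd_of_one_vadd_ne h (by simp only [hx', ← h1]))
    · simp

end PrimeOrbits

/-! ### Shift invariants as orbit products plus traces -/

section ShiftStep

open MvPolynomial

variable {p : ℕ} [Fact p.Prime] {J : Type*}

/-- Translation of the second coordinate. -/
def shift (p : ℕ) (J : Type*) (k : ZMod p) (x : J × ZMod p) : J × ZMod p := (x.1, x.2 + k)

lemma shift_injective (k : ZMod p) : Function.Injective (shift p J k) := by
  rintro ⟨a, b⟩ ⟨c, d⟩ h
  simpa [shift] using h

/-- The action of `ℤ/p` on the exponents of monomials by translation of the second coordinate. -/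
@[reducible] noncomputable def exponentShift (p : ℕ) (J : Type*) :
    AddAction (ZMod p) (J × ZMod p →₀ ℕ) where
  vadd k d := d.mapDomain (shift p J k)
  zero_vadd d := by
    change d.mapDomain (shift p J 0) = d
    convert Finsupp.mapDomain_id
    ext x <;> simp [shift]
  add_vadd k l d := by
    change d.mapDomain (shift p J (k + l)) = (d.mapDomain (shift p J l)).mapDomain (shift p J k)
    rw [← Finsupp.mapDomain_comp]
    congr 1
    ext x
    · simp [shift]
    · simp [shift, add_comm, add_left_comm]

variable {K : Type*} [Field K]

lemma coeff_rename_shift (k : ZMod p) (f : MvPolynomial (J × ZMod p) K) (d : J × ZMod p →₀ ℕ) :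
    coeff d (rename (shift p J (-k)) f) = coeff (d.mapDomain (shift p J k)) f := by
  let _ := exponentShift p J
  have : d = (d.mapDomain (shift p J k)).mapDomain (shift p J (-k)) :=
    (neg_vadd_vadd k d).symm
  conv_lhs => rw [this]
  exact coeff_rename_mapDomain _ (shift_injective _) _ _

variable [Fintype J]

/-- The product of the variables in the orbit with index `i`. -/
noncomputable def orbitProd (p : ℕ) [Fact p.Prime] (K : Type*) [Field K] (i : J) :
    MvPolynomial (J × ZMod p) K :=
  ∏ k : ZMod p, X (i, k)

lemma orbitProd_pow_monomial (d : J × ZMod p →₀ ℕ)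
    (hd : d.mapDomain (shift p J 1) = d) :
    (monomial d (1 : K)) = aeval (orbitProd p K)
      (monomial (Finsupp.equivFunOnFinite.symm fun i : J => d (i, 0)) (1 : K)) := by
  let _ := exponentShift p J
  have h0 : ∀ i k, d (i, k) = d (i, 0) := by
    intro i k
    have h : d.mapDomain (shift p J k) = d := vadd_eq_of_one_vadd_eq (p := p) hd k
    have := Finsupp.mapDomain_apply (shift_injective (J := J) k) d (i, 0)
    rw [h] at this
    simpa [shift] using this
  rw [aeval_monomial, map_one (algebraMap K _), one_mul, monomial_eq, C_1, one_mul,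
    Finsupp.prod_fintype _ _ (by simp), Finsupp.prod_fintype _ _ (by simp), Fintype.prod_prod_type]
  refine Finset.prod_congr rfl fun i _ => ?_
  simp [orbitProd, h0, Finset.prod_pow]

/-- Shift-fixed monomials are monomials in the orbit products; the free orbits of monomials add up
to a trace. The support conditions let degree hypotheses on `f` pass to both parts. -/
lemma exists_orbit_decomposition (f : MvPolynomial (J × ZMod p) K)
    (hf : ∀ k, rename (shift p J k) f = f) :
    ∃ (F : MvPolynomial J K) (m : MvPolynomial (J × ZMod p) K),
      f = aeval (orbitProd p K) F + ∑ k : ZMod p, rename (shift p J k) m ∧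
      (∀ d, coeff d f = 0 → coeff d (aeval (orbitProd p K) F) = 0) ∧
      ∀ d, coeff d f = 0 → coeff d m = 0 := by
  classical
  let _ := exponentShift p J
  have hc : ∀ (k : ZMod p) (d : J × ZMod p →₀ ℕ), coeff (k +ᵥ d) f = coeff d f := by
    intro k d
    nth_rewrite 2 [← hf (-k)]
    exact (coeff_rename_shift k f d).symm
  obtain ⟨m, hm, hm0, hm1⟩ := exists_orbit_section (p := p) (fun d => coeff d f) hc
  let G : MvPolynomial (J × ZMod p) K :=
    ∑ d ∈ f.support with d.mapDomain (shift p J 1) = d, monomial d (coeff d f)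
  let M : MvPolynomial (J × ZMod p) K := ∑ d ∈ f.support, monomial d (m d)
  have hG : ∀ d, coeff d G = if d.mapDomain (shift p J 1) = d then coeff d f else 0 := by
    intro d
    simp only [G, coeff_sum, coeff_monomial, Finset.sum_ite_eq', Finset.mem_filter, mem_support_iff]
    by_cases h : coeff d f = 0 <;> simp [h]
  have hM : ∀ d, coeff d M = m d := by
    intro d
    simp only [M, coeff_sum, coeff_monomial, Finset.sum_ite_eq', mem_support_iff]
    split_ifs with h
    · rfl
    · rcases hm d with h' | h'
      · rw [h']; simpa using Eq.symm (not_not.1 h)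
      · exact h'.symm
  obtain ⟨F, hGF⟩ : ∃ F, G = aeval (orbitProd p K) F := by
    refine ⟨∑ d ∈ f.support with d.mapDomain (shift p J 1) = d,
      monomial (Finsupp.equivFunOnFinite.symm fun i : J => d (i, 0)) (coeff d f), ?_⟩
    rw [map_sum]
    refine Finset.sum_congr rfl fun d hd => ?_
    rw [← mul_one (coeff d f), ← smul_eq_mul, ← smul_monomial, ← smul_monomial, map_smul,
      orbitProd_pow_monomial d (Finset.mem_filter.1 hd).2]
  refine ⟨F, M, ?_, ?_, ?_⟩
  · rw [← hGF]
    ext d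
    rw [coeff_add, hG, coeff_sum]
    have : ∑ k : ZMod p, coeff d (rename (shift p J k) M) = ∑ k : ZMod p, m (k +ᵥ d) := by
      rw [← Equiv.sum_comp (Equiv.neg (ZMod p))]
      refine Finset.sum_congr rfl fun k _ => ?_
      rw [Equiv.neg_apply, coeff_rename_shift, hM]
      rfl
    rw [this]
    split_ifs with h
    · rw [hm0 d h, add_zero]
    · rw [hm1 d h, zero_add]
  · intro d hd
    rw [← hGF, hG, hd, ite_self]
  · intro d hd
    rw [hM]
    rcases hm d with h' | h'
    · rw [h', hd]
    · exact h'

end ShiftStep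

/-! ### Descent of the condition D f = 0 to the orbit variables -/

section ShiftStep

open MvPolynomial

variable {p : ℕ} {J : Type*} {K : Type*} [Field K]

/-- The substitution of `z i + t` for each variable in the orbit with index `i`. -/
noncomputable def orbitTranslate (p : ℕ) (J K : Type*) [Field K] :
    MvPolynomial (J × ZMod p) K →ₐ[K] Polynomial (MvPolynomial J K) :=
  aeval fun x => Polynomial.C (X x.1) + Polynomial.X

lemma orbitTranslate_X (x : J × ZMod p) :
    orbitTranslate p J K (X x) = Polynomial.C (X x.1) + Polynomial.X := by
  simp [orbitTranslate]

lemma orbitTranslate_C (c : K) :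
    orbitTranslate p J K (C c) = Polynomial.C (C c) := by
  rw [orbitTranslate, aeval_C]; rfl

lemma orbitTranslate_rename_shift (k : ZMod p) (f : MvPolynomial (J × ZMod p) K) :
    orbitTranslate p J K (rename (shift p J k) f) = orbitTranslate p J K f := by
  rw [orbitTranslate, aeval_rename]
  rfl

variable [Fact p.Prime]

lemma orbitTranslate_orbitProd [CharP K p] (i : J) :
    orbitTranslate p J K (orbitProd p K i) = Polynomial.C (X i ^ p) + Polynomial.X ^ p := by
  rw [orbitProd, map_prod]
  simp only [orbitTranslate_X]
  rw [Finset.prod_const, Finset.card_univ, ZMod.card, add_pow_char, Polynomial.C_pow]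

variable [Fintype J]

/-- Chain rule: under z_i + t every variable moves with unit speed. -/
lemma orbitTranslate_sum_pderiv (f : MvPolynomial (J × ZMod p) K) :
    orbitTranslate p J K (∑ x, pderiv x f) = Polynomial.derivative (orbitTranslate p J K f) := by
  classical
  induction f using MvPolynomial.induction_on with
  | C a => simp
  | add f g hf hg => simp only [map_add, Finset.sum_add_distrib, hf, hg]
  | mul_X f i hf =>
    simp only [Derivation.leibniz, smul_eq_mul, Finset.sum_add_distrib, map_add, map_mul,
      ← Finset.mul_sum, hf, Polynomial.derivative_mul, pderiv_X, orbitTranslate_X,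
      Polynomial.derivative_C, Polynomial.derivative_X, Pi.single_apply]
    simp only [Finset.sum_ite_eq, Finset.mem_univ, if_true, map_one]
    ring

lemma pderiv_orbitProd [DecidableEq J] (i j : J) :
    pderiv (j, (0 : ZMod p)) (orbitProd p K i) =
      if i = j then ∏ k ∈ Finset.univ.erase (0 : ZMod p), X (i, k) else 0 := by
  have h : ∀ s : Finset (ZMod p), 0 ∉ s →
      pderiv (j, (0 : ZMod p)) (∏ k ∈ s, X (i, k) : MvPolynomial (J × ZMod p) K) = 0 := by
    intro s hs
    induction s using Finset.induction_on with
    | empty => simp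
    | insert k s hk ih =>
      rw [Finset.mem_insert, not_or] at hs
      rw [Finset.prod_insert hk, Derivation.leibniz, ih hs.2,
        pderiv_X_of_ne fun h => hs.1 (Prod.mk.inj h).2.symm, smul_zero, smul_zero, add_zero]
  rw [orbitProd, ← Finset.mul_prod_erase _ _ (Finset.mem_univ (0 : ZMod p)), Derivation.leibniz,
    h _ (by simp), smul_zero, zero_add, smul_eq_mul]
  split_ifs with hij
  · rw [hij, pderiv_X_self, mul_one]
  · rw [pderiv_X_of_ne, mul_zero]
    exact fun h => hij (Prod.mk.inj h).1

lemma orbitTranslate_sum_pderiv_orbitProd (i : J) :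
    orbitTranslate p J K (∑ j, pderiv (j, (0 : ZMod p)) (orbitProd p K i)) =
      (Polynomial.C (X i) + Polynomial.X) ^ (p - 1) := by
  classical
  simp only [pderiv_orbitProd, Finset.sum_ite_eq, Finset.mem_univ, if_true, map_prod,
    orbitTranslate_X, Finset.prod_const]
  rw [Finset.card_erase_of_mem (Finset.mem_univ _), Finset.card_univ, ZMod.card]

/-- In characteristic p an orbit product becomes (z_i + t)^p = z_i^p + t^p. -/
lemma X_pow_dvd_orbitTranslate_sub [CharP K p] (F : MvPolynomial J K) :
    Polynomial.X ^ p ∣ orbitTranslate p J K (aeval (orbitProd p K) F) -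
      Polynomial.C (expand p F) := by
  rw [← Ideal.mem_span_singleton, ← Ideal.Quotient.eq]
  induction F using MvPolynomial.induction_on with
  | C a => rw [aeval_C, expand_C, algebraMap_eq, orbitTranslate_C]
  | add f g hf hg => simp only [map_add, hf, hg]
  | mul_X f i hf =>
    simp only [map_mul, hf, aeval_X, orbitTranslate_orbitProd, expand_X, map_add]
    rw [Ideal.Quotient.eq_zero_iff_mem.2 (Ideal.mem_span_singleton_self _), add_zero]

lemma X_pow_dvd_orbitTranslate_pderiv_sub [CharP K p] (F : MvPolynomial J K) :
    Polynomial.X ^ p ∣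
      orbitTranslate p J K (∑ j, pderiv (j, (0 : ZMod p)) (aeval (orbitProd p K) F)) -
      ∑ i, Polynomial.C (expand p (pderiv i F)) *
        (Polynomial.C (X i) + Polynomial.X) ^ (p - 1) := by
  classical
  have hX := fun F : MvPolynomial J K => X_pow_dvd_orbitTranslate_sub (p := p) F
  simp only [← Ideal.mem_span_singleton, ← Ideal.Quotient.eq] at hX ⊢
  induction F using MvPolynomial.induction_on with
  | C a => simp [algebraMap_eq]
  | add f g hf hg =>
    simp only [map_add, add_mul, Finset.sum_add_distrib] at hf hg ⊢
    rw [hf, hg]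
  | mul_X f i hf =>
    simp only [map_mul, Derivation.leibniz, smul_eq_mul, Finset.sum_add_distrib, map_add,
      ← Finset.mul_sum, aeval_X, add_mul, pderiv_X, orbitTranslate_sum_pderiv_orbitProd] at hf ⊢
    rw [hf, hX]
    congr 1
    · simp [Pi.single_apply, apply_ite, ite_mul]
    · have : ∀ j, Polynomial.C (expand p (X i)) * Polynomial.C (expand p (pderiv j f)) *
          (Polynomial.C (X j) + Polynomial.X) ^ (p - 1) = Polynomial.C (expand p (X i)) *
          (Polynomial.C (expand p (pderiv j f)) *
          (Polynomial.C (X j) + Polynomial.X) ^ (p - 1)) := fun j => mul_assoc _ _ _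
      simp only [this, ← Finset.mul_sum, map_mul]
      rw [orbitTranslate_orbitProd, map_add, expand_X,
        Ideal.Quotient.eq_zero_iff_mem.2 (Ideal.mem_span_singleton_self
          (Polynomial.X ^ p : Polynomial (MvPolynomial J K))), add_zero]

/-- Modulo t^p the chain rule leaves Σ (∂_i F)(z^p) (z_i + t)^(p-1), and t^(p-1) has coefficient 1
in each power. -/
lemma coeff_orbitTranslate_pderiv [CharP K p] (F : MvPolynomial J K) :
    (orbitTranslate p J K (∑ j, pderiv (j, (0 : ZMod p)) (aeval (orbitProd p K) F))).coeff (p - 1) =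
      expand p (∑ i, pderiv i F) := by
  have hp : p - 1 < p := Nat.sub_lt (Fact.out : p.Prime).pos one_pos
  obtain ⟨R, hR⟩ := X_pow_dvd_orbitTranslate_pderiv_sub (p := p) F
  rw [sub_eq_iff_eq_add.1 hR, Polynomial.coeff_add, Polynomial.coeff_X_pow_mul', if_neg (by omega),
    zero_add, Polynomial.finsetSum_coeff, map_sum]
  refine Finset.sum_congr rfl fun i _ => ?_
  rw [Polynomial.coeff_C_mul, add_comm, Polynomial.coeff_X_add_C_pow]
  simp

/-- For invariant `G`, the derivative at (j, k) is the k-th shift of the derivative at (j, 0); so D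
G is a trace. -/
lemma sum_rename_shift_pderiv (G : MvPolynomial (J × ZMod p) K)
    (hG : ∀ k, rename (shift p J k) G = G) :
    ∑ k : ZMod p, rename (shift p J k) (∑ j, pderiv (j, (0 : ZMod p)) G) = ∑ x, pderiv x G := by
  rw [Fintype.sum_prod_type, Finset.sum_comm]
  refine Finset.sum_congr rfl fun k _ => ?_
  rw [map_sum]
  refine Finset.sum_congr rfl fun j _ => ?_
  rw [← pderiv_rename (shift_injective k), hG]
  simp [shift]

lemma rename_shift_sum_pderiv (G : MvPolynomial (J × ZMod p) K) (k : ZMod p) :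
    rename (shift p J k) (∑ x, pderiv x G) = ∑ x, pderiv x (rename (shift p J k) G) := by
  rw [map_sum, ← Equiv.sum_comp (Equiv.prodCongr (Equiv.refl J) (Equiv.addRight k))
    (fun x => pderiv x (rename (shift p J k) G))]
  exact Finset.sum_congr rfl fun x _ => (pderiv_rename (shift_injective k) x G).symm

lemma coeff_pderiv_eq_zero_of_dvd {I : Type*} {f : MvPolynomial I K}
    (hf : ∀ d, coeff d f ≠ 0 → p ∣ d.degree) (i : I) {d : I →₀ ℕ} (hd : p ∣ d.degree) :
    coeff d (pderiv i f) = 0 := by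
  rw [coeff_pderiv]
  by_contra h
  have h1 := hf _ (left_ne_zero_of_mul h)
  rw [map_add, Finsupp.degree_single, Nat.dvd_add_right hd] at h1
  exact (Fact.out : p.Prime).one_lt.ne' (Nat.dvd_one.1 h1)

/-- Identifying the variables of each orbit kills traces, which become p-fold sums, and turns orbit
products into p-th powers. The delicate point is that `F` inherits D F = 0: this is read off from
the t^(p-1) coefficient after `orbitTranslate`. -/
theorem exists_expand_eq_rename_fst [CharP K p] (f : MvPolynomial (J × ZMod p) K)
    (hf : ∀ k, rename (shift p J k) f = f) (hD : ∑ x, pderiv x f = 0)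
    (hdeg : ∀ d, coeff d f ≠ 0 → p ∣ d.degree) :
    ∃ F : MvPolynomial J K, rename Prod.fst f = expand p F ∧ ∑ i, pderiv i F = 0 := by
  have hp : p.Prime := Fact.out
  obtain ⟨F, m, hfm, hF, hm⟩ := exists_orbit_decomposition f hf
  set G := aeval (orbitProd p K) F with hGdef
  have hGs : ∀ k, rename (shift p J k) G = G := by
    intro k
    have : (rename (shift p J k)).comp (aeval (orbitProd p K)) = aeval (orbitProd p K) := by
      ext i : 1
      simp only [AlgHom.comp_apply, aeval_X, orbitProd, map_prod, rename_X, shift]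
      exact Equiv.prod_comp (Equiv.addRight k) fun l => X (i, l)
    exact DFunLike.congr_fun this F
  refine ⟨F, ?_, ?_⟩
  · rw [hfm, map_add, map_sum]
    have h1 : ∀ k, rename Prod.fst (rename (shift p J k) m) = rename Prod.fst m := by
      intro k
      rw [rename_rename]
      rfl
    simp only [h1, Finset.sum_const, Finset.card_univ, ZMod.card]
    rw [nsmul_eq_mul, CharP.cast_eq_zero, zero_mul, add_zero]
    have : (rename Prod.fst).comp (aeval (orbitProd p K)) = expand p (σ := J) (R := K) := by
      ext i : 1
      simp [orbitProd]
    exact DFunLike.congr_fun this F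
  · refine (expand_eq_zero hp.pos).1 ?_
    rw [← coeff_orbitTranslate_pderiv]
    -- Chosen so that the trace of `g` is D G + D(Tr m) = D f = 0.
    set g := ∑ j, pderiv (j, (0 : ZMod p)) G + ∑ x, pderiv x m with hg
    -- The t^(p-1) coefficient of a t-derivative is a multiple of p.
    have hm0 : (orbitTranslate p J K (∑ x, pderiv x m)).coeff (p - 1) = 0 := by
      rw [orbitTranslate_sum_pderiv, Polynomial.coeff_derivative, ← Nat.cast_succ,
        Nat.succ_eq_add_one, Nat.sub_add_cancel hp.pos, CharP.cast_eq_zero, mul_zero]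
    -- The functional is shift invariant and `g` has trace zero, so only fixed monomials could
    -- contribute.
    have hg0 : (orbitTranslate p J K g).coeff (p - 1) = 0 := by
      let _ := exponentShift p J
      have key := sum_smul_eq_zero_of_orbit_sums (p := p) g.support (fun d => coeff d g)
        (fun d => (orbitTranslate p J K (monomial d 1)).coeff (p - 1))
        (fun d hd => notMem_support_iff.1 hd) ?_ ?_ ?_
      · rw [← key]
        conv_lhs => rw [g.as_sum]
        rw [map_sum, Polynomial.finsetSum_coeff]
        refine Finset.sum_congr rfl fun d _ => ?_
        rw [← mul_one (coeff d g), ← smul_eq_mul, ← smul_monomial, map_smul,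
          Polynomial.coeff_smul, smul_eq_mul, mul_one]
      · intro k d
        rw [← orbitTranslate_rename_shift k (monomial d 1), rename_monomial]
        rfl
      · intro d
        have h1 : ∑ k, rename (shift p J k) g = 0 := by
          simp only [hg, map_add, Finset.sum_add_distrib, rename_shift_sum_pderiv]
          rw [sum_rename_shift_pderiv G hGs, ← hD, hfm]
          simp only [map_add, map_sum, Finset.sum_add_distrib]
          rw [Finset.sum_comm]
        have h2 := congrArg (coeff d) h1
        rw [coeff_sum, coeff_zero, ← Equiv.sum_comp (Equiv.neg (ZMod p))] at h2
        rw [← h2]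
        refine Finset.sum_congr rfl fun k _ => ?_
        exact (coeff_rename_shift k g d).symm
      -- Fixed monomials have degree divisible by p, whereas those of `g` have degree ≡ -1 mod p.
      · intro d hd
        have hdvd : p ∣ d.degree := by
          have h0 : ∀ i k, d (i, k) = d (i, 0) := by
            intro i k
            have h : d.mapDomain (shift p J k) = d := vadd_eq_of_one_vadd_eq (p := p) hd k
            have := Finsupp.mapDomain_apply (shift_injective (J := J) k) d (i, 0)
            rw [h] at this
            simpa [shift] using this
          rw [Finsupp.degree_eq_sum, Fintype.sum_prod_type]
          refine Finset.dvd_sum fun i _ => ?_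
          simp [h0]
        have hGd : ∀ d, coeff d G ≠ 0 → p ∣ d.degree := fun d h => hdeg d (mt (hF d) h)
        have hmd : ∀ d, coeff d m ≠ 0 → p ∣ d.degree := fun d h => hdeg d (mt (hm d) h)
        rw [hg, coeff_add, coeff_sum, coeff_sum,
          Finset.sum_eq_zero fun j _ => coeff_pderiv_eq_zero_of_dvd hGd _ hdvd,
          Finset.sum_eq_zero fun j _ => coeff_pderiv_eq_zero_of_dvd hmd _ hdvd, add_zero]
    rw [hg, map_add, Polynomial.coeff_add, hm0, add_zero] at hg0
    exact hg0

end ShiftStep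

open Module

/-! ### Cyclically invariant polynomials at (1, …, 1) -/

section CyclicShift

open MvPolynomial

variable {p : ℕ} [Fact p.Prime] {K : Type*} [Field K]

/-- The decomposition of `ℤ/p^(b+1)` into the cosets of the subgroup of order `p`. -/
noncomputable def cosetEquiv (p b : ℕ) [Fact p.Prime] :
    ZMod (p ^ b) × ZMod p ≃ ZMod (p ^ (b + 1)) :=
  Equiv.ofBijective (fun x => ((x.1.val + x.2.val * p ^ b : ℕ) : ZMod (p ^ (b + 1)))) <| by
    rw [Fintype.bijective_iff_injective_and_card]
    refine ⟨?_, by simp [ZMod.card, pow_succ]⟩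
    have hb : 0 < p ^ b := pow_pos (Fact.out : p.Prime).pos b
    have hlt : ∀ x : ZMod (p ^ b) × ZMod p, x.1.val + x.2.val * p ^ b < p ^ (b + 1) := by
      intro x
      have h1 := ZMod.val_lt x.1
      have h2 := ZMod.val_lt x.2
      calc _ < p ^ b + x.2.val * p ^ b := by omega
        _ = (x.2.val + 1) * p ^ b := by ring
        _ ≤ p * p ^ b := Nat.mul_le_mul_right _ h2
        _ = p ^ (b + 1) := by ring
    intro x y hxy
    have h := congrArg ZMod.val hxy
    simp only [ZMod.val_natCast, Nat.mod_eq_of_lt (hlt _)] at h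
    have h1 : x.1.val = y.1.val := by
      have := congrArg (· % p ^ b) h
      simpa [Nat.mod_eq_of_lt (ZMod.val_lt x.1), Nat.mod_eq_of_lt (ZMod.val_lt y.1)] using this
    have h2 : x.2.val = y.2.val := by
      rw [h1, Nat.add_left_cancel_iff] at h
      exact Nat.eq_of_mul_eq_mul_right hb h
    exact Prod.ext (ZMod.val_injective _ h1) (ZMod.val_injective _ h2)

lemma cosetEquiv_apply (b : ℕ) (x : ZMod (p ^ b) × ZMod p) :
    cosetEquiv p b x = x.1.val + x.2.val * (p : ZMod (p ^ (b + 1))) ^ b := by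
  simp [cosetEquiv]

lemma castHom_cosetEquiv (b : ℕ) (x : ZMod (p ^ b) × ZMod p) :
    ZMod.castHom (pow_dvd_pow p b.le_succ) (ZMod (p ^ b)) (cosetEquiv p b x) = x.1 := by
  have : (p : ZMod (p ^ b)) ^ b = 0 := by
    rw [← Nat.cast_pow, ZMod.natCast_self]
  rw [cosetEquiv_apply]
  simp only [map_add, map_mul, map_natCast, map_pow, this, mul_zero, add_zero,
    ZMod.natCast_zmod_val]

lemma cosetEquiv_shift (b : ℕ) (k : ZMod p) (x : ZMod (p ^ b) × ZMod p) :
    cosetEquiv p b (shift p _ k x) = cosetEquiv p b x + k.val * (p : ZMod (p ^ (b + 1))) ^ b := by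
  have hz : (p : ZMod (p ^ (b + 1))) * (p : ZMod (p ^ (b + 1))) ^ b = 0 := by
    rw [← pow_succ', ← Nat.cast_pow, ZMod.natCast_self]
  rw [cosetEquiv_apply, cosetEquiv_apply, shift]
  have h := Nat.mod_add_div (x.2.val + k.val) p
  rw [← ZMod.val_add] at h
  have h' := congrArg (fun n : ℕ => (n : ZMod (p ^ (b + 1)))) h
  push_cast at h'
  rw [add_assoc, ← add_mul, ← h', add_mul, mul_right_comm, hz, zero_mul, add_zero]

lemma rename_add_eq {n : ℕ} {f : MvPolynomial (ZMod n) K}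
    (hf : rename (fun j => j + 1) f = f) (m : ℕ) : rename (fun j => j + (m : ZMod n)) f = f := by
  induction m with
  | zero =>
    convert rename_id_apply f
    simp
  | succ m ih =>
    conv_rhs => rw [← hf, ← ih, rename_rename]
    congr 2
    ext j
    simp [add_assoc]

/-- Identifying variables along the cosets of the subgroup of order p turns `f` into F(z^p), where
`F` satisfies the same hypotheses for `b`. Since 1^p = 1, the value at (1, …, 1) does not change. -/
theorem aeval_one_eq_zero_of_shift_invariant [CharP K p] (b : ℕ)
    (f : MvPolynomial (ZMod (p ^ b)) K)
    (hf : rename (fun j => j + 1) f = f) (hD : ∑ j, pderiv j f = 0)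
    (hh : f.IsHomogeneous (p ^ b)) : aeval (fun _ => (1 : K)) f = 0 := by
  have hp : p.Prime := Fact.out
  induction b with
  | zero =>
    -- Euler's identity in degree 1, evaluated where all variables are 1.
    have h1 := congrArg (aeval fun _ => (1 : K)) hh.sum_X_mul_pderiv
    have h2 := congrArg (aeval fun _ => (1 : K)) hD
    simp only [map_sum, map_mul, aeval_X, one_mul, map_zero] at h1 h2
    rw [h2, map_nsmul] at h1
    exact (h1.trans (one_smul ℕ _)).symm
  | succ b ih =>
    set c := ZMod.castHom (pow_dvd_pow p b.le_succ) (ZMod (p ^ b)) with hc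
    let e := cosetEquiv p b
    have h1 : ∀ k, rename (shift p _ k) (rename e.symm f) = rename e.symm f := by
      intro k
      rw [rename_rename]
      conv_rhs => rw [← rename_add_eq hf (k.val * p ^ b), rename_rename]
      congr 2
      ext1 j
      rw [Function.comp_apply, Function.comp_apply, Equiv.eq_symm_apply]
      change cosetEquiv p b _ = _
      rw [cosetEquiv_shift]
      push_cast
      congr 1
      exact (cosetEquiv p b).apply_symm_apply j
    have h2 : ∑ x, pderiv x (rename e.symm f) = 0 := by
      have := congrArg (rename e.symm) hD
      rw [map_sum, map_zero] at this
      rw [← this, ← Equiv.sum_comp e.symm]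
      exact Finset.sum_congr rfl fun j _ => pderiv_rename e.symm.injective _ _
    have h3 : ∀ d, coeff d (rename e.symm f) ≠ 0 → p ∣ d.degree := by
      intro d hd
      rw [of_not_not fun h => hd ((hh.rename_isHomogeneous (f := e.symm)).coeff_eq_zero h)]
      exact dvd_pow_self p b.succ_ne_zero
    obtain ⟨F, hF, hFD⟩ := exists_expand_eq_rename_fst (rename e.symm f) h1 h2 h3
    have hF' : rename c f = expand p F := by
      rw [← hF, rename_rename]
      congr 2
      ext1 j
      rw [Function.comp_apply, ← castHom_cosetEquiv]
      exact congrArg c (e.apply_symm_apply j).symm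
    have h0 := ih F ?_ hFD ?_
    · have h1 := congrArg (aeval fun _ => (1 : K)) hF'
      rw [aeval_rename, aeval_expand] at h1
      rw [← h0]
      convert h1 using 3
      · rfl
      · exact (one_pow p).symm
    · refine expand_injective hp.pos ?_
      rw [← rename_expand, ← hF', rename_rename]
      conv_rhs => rw [← hf, rename_rename]
      congr 2
      ext1 j
      simp
    · intro d hd
      have h1 : (expand p F).IsHomogeneous (p ^ (b + 1)) := hF' ▸ hh.rename_isHomogeneous
      rw [← coeff_expand_smul p hp.ne_zero] at hd
      have h2 := of_not_not fun h => hd (h1.coeff_eq_zero h)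
      rw [map_nsmul, smul_eq_mul, pow_succ'] at h2
      rw [show Finsupp.weight 1 d = d.degree from
        (DFunLike.congr_fun Finsupp.degree_eq_weight_one d).symm]
      exact Nat.eq_of_mul_eq_mul_left hp.pos h2

end CyclicShift

/-! ### Polynomial functions on lines and along families of vectors -/

section Evaluation

variable {K V : Type*} [Field K] [AddCommGroup V] [Module K V]

lemma polyRing_algHom_ext {A : Type*} [CommSemiring A] [Algebra K A] {F G : PolyRing K V →ₐ[K] A}
    (h : ∀ l, F (SymmetricAlgebra.ι K (Dual K V) l) = G (SymmetricAlgebra.ι K (Dual K V) l)) :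
    F = G :=
  SymmetricAlgebra.algHom_ext (LinearMap.ext h)

/-- The endomorphism of `K[V]` that substitutes `g v` for the variable vector `v`. -/
noncomputable def substEnd (g : V →ₗ[K] V) : PolyRing K V →ₐ[K] PolyRing K V :=
  SymmetricAlgebra.lift (SymmetricAlgebra.ι K (Dual K V) ∘ₗ Dual.transpose g)

lemma substEnd_ι (g : V →ₗ[K] V) (l : Dual K V) :
    substEnd g (SymmetricAlgebra.ι K (Dual K V) l) = SymmetricAlgebra.ι K (Dual K V) (l ∘ₗ g) := by
  rw [substEnd, SymmetricAlgebra.lift_ι_apply]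
  rfl

lemma substEnd_mul (g h : V →ₗ[K] V) : substEnd (g * h) = (substEnd h).comp (substEnd g) := by
  refine polyRing_algHom_ext fun l => ?_
  simp [substEnd_ι, LinearMap.comp_assoc, Module.End.mul_eq_comp]

lemma substEnd_pow_apply {g : V →ₗ[K] V} {f : PolyRing K V} (hf : substEnd g f = f) (n : ℕ) :
    substEnd (g ^ n) f = f := by
  induction n with
  | zero =>
    have : substEnd (1 : V →ₗ[K] V) = AlgHom.id K _ := by
      refine polyRing_algHom_ext fun l => ?_
      simp [substEnd_ι]
      rfl
    simp [this]
  | succ n ih => rw [pow_succ, substEnd_mul, AlgHom.comp_apply, ih, hf]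

/-- Restriction of polynomial functions to the line through `v`. -/
noncomputable def lineEval (v : V) : PolyRing K V →ₐ[K] Polynomial K :=
  SymmetricAlgebra.lift (LinearMap.toSpanSingleton K _ Polynomial.X ∘ₗ Dual.eval K V v)

lemma lineEval_ι (v : V) (l : Dual K V) :
    lineEval v (SymmetricAlgebra.ι K (Dual K V) l) = l v • (Polynomial.X : Polynomial K) := by
  rw [lineEval, SymmetricAlgebra.lift_ι_apply]
  rfl

/-- The pullback of polynomial functions along the linear map from `K^J` to `V` that sends the
standard basis to the family `u`. -/
noncomputable def pullback {J : Type*} [Fintype J] (u : J → V) :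
    PolyRing K V →ₐ[K] MvPolynomial J K :=
  SymmetricAlgebra.lift
    (∑ j, LinearMap.toSpanSingleton K _ (MvPolynomial.X j) ∘ₗ Dual.eval K V (u j))

lemma pullback_ι {J : Type*} [Fintype J] (u : J → V) (l : Dual K V) :
    pullback u (SymmetricAlgebra.ι K (Dual K V) l) =
      ∑ j, l (u j) • (MvPolynomial.X j : MvPolynomial J K) := by
  rw [pullback, SymmetricAlgebra.lift_ι_apply, LinearMap.sum_apply]
  rfl

/-- The pullback along `u`, together with a first order deformation in the direction `w`. -/
noncomputable def pullbackDeform {J : Type*} [Fintype J] (u : J → V) (w : V) :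
    PolyRing K V →ₐ[K] Polynomial (MvPolynomial J K) :=
  SymmetricAlgebra.lift
    ((Algebra.linearMap (MvPolynomial J K) (Polynomial (MvPolynomial J K))).restrictScalars K ∘ₗ
      (pullback u).toLinearMap ∘ₗ SymmetricAlgebra.ι K (Dual K V) +
      LinearMap.toSpanSingleton K _ Polynomial.X ∘ₗ Dual.eval K V w)

lemma pullbackDeform_ι {J : Type*} [Fintype J] (u : J → V) (w : V) (l : Dual K V) :
    pullbackDeform u w (SymmetricAlgebra.ι K (Dual K V) l) =
      Polynomial.C (pullback u (SymmetricAlgebra.ι K (Dual K V) l)) +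
        l w • (Polynomial.X : Polynomial (MvPolynomial J K)) := by
  rw [pullbackDeform, SymmetricAlgebra.lift_ι_apply]
  rfl

lemma pullbackDeform_coeff_zero {J : Type*} [Fintype J] (u : J → V) (w : V) (f : PolyRing K V) :
    (pullbackDeform u w f).coeff 0 = pullback u f := by
  have : ((Polynomial.aeval (0 : MvPolynomial J K)).restrictScalars K).comp (pullbackDeform u w) =
      pullback u := by
    refine polyRing_algHom_ext fun l => ?_
    simp only [AlgHom.comp_apply,
      pullbackDeform_ι]
    simp
  rw [← this, Polynomial.coeff_zero_eq_aeval_zero]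
  rfl

/-- The coefficient of t is the directional derivative at Σ z_j u_j; it is additive in the
direction, and direction `u j` gives ∂_j of the pullback. -/
lemma pullbackDeform_add_sum {J : Type*} [Fintype J] (u : J → V) (w : V) (f : PolyRing K V) :
    (pullbackDeform u (w + ∑ j, u j) f).coeff 1 =
      (pullbackDeform u w f).coeff 1 + ∑ j, MvPolynomial.pderiv j (pullback u f) := by
  classical
  induction f using SymmetricAlgebra.induction with
  | algebraMap r =>
    rw [AlgHom.commutes, AlgHom.commutes, AlgHom.commutes]
    simp
  | ι l =>
    rw [pullbackDeform_ι, pullbackDeform_ι, pullback_ι]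
    simp [Pi.single_apply, MvPolynomial.pderiv_X, map_sum, add_smul, Finset.sum_smul,
      Polynomial.coeff_X]
  | mul a b ha hb =>
    simp only [map_mul, Polynomial.mul_coeff_one, ha, hb, pullbackDeform_coeff_zero,
      Derivation.leibniz, smul_eq_mul, Finset.sum_add_distrib, ← Finset.mul_sum]
    ring
  | add a b ha hb =>
    simp only [map_add, Polynomial.coeff_add, ha, hb, Finset.sum_add_distrib]
    ring

lemma coeff_lineEval_eq {J : Type*} [Fintype J] (u : J → V) (f : PolyRing K V) (n : ℕ) :
    (lineEval (∑ j, u j) f).coeff n =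
      MvPolynomial.aeval (fun _ => (1 : K))
        (MvPolynomial.homogeneousComponent n (pullback u f)) := by
  have h1 : lineEval (∑ j, u j) =
      (MvPolynomial.aeval fun _ : J => (Polynomial.X : Polynomial K)).comp (pullback u) := by
    refine polyRing_algHom_ext fun l => ?_
    simp only [AlgHom.comp_apply, lineEval_ι,
      pullback_ι, map_sum, map_smul, MvPolynomial.aeval_X, Finset.sum_smul]
  rw [h1, AlgHom.comp_apply]
  induction pullback u f using MvPolynomial.induction_on' with
  | monomial d a =>
    rw [MvPolynomial.aeval_monomial, MvPolynomial.homogeneousComponent_of_mem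
      (MvPolynomial.isHomogeneous_monomial a rfl)]
    simp only [Finsupp.prod, Finset.prod_pow_eq_pow_sum, Polynomial.algebraMap_eq,
      Polynomial.coeff_C_mul, Polynomial.coeff_X_pow]
    change a * (if n = d.degree then 1 else 0) = _
    split_ifs <;> simp [MvPolynomial.aeval_monomial]
  | add a b ha hb => simp only [map_add, Polynomial.coeff_add, ha, hb]

end Evaluation

/-! ### Invariants on the line through a fixed vector -/

section FixedVectors

variable {p : ℕ} [Fact p.Prime] {K V : Type*} [Field K] [CharP K p] [AddCommGroup V] [Module K V]

theorem coeff_lineEval_eq_zero {g : V →ₗ[K] V} {f : PolyRing K V} (hf : substEnd g f = f)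
    (b : ℕ) {v w : V} (hw : (g ^ p ^ b) w = w + v) (hv : g v = v) :
    (lineEval v f).coeff (p ^ b) = 0 := by
  set q := p ^ b with hq
  -- Telescoping gives Σ_{j<q} g^j u₀ = g^q w - w = v, and `g^q` fixes `u₀` because `g` fixes `v`.
  set u₀ := g w - w with hu₀
  let u : ZMod q → V := fun j => (g ^ j.val) u₀
  have hper : (g ^ q) u₀ = u₀ := by
    rw [hu₀, map_sub, ← Module.End.mul_apply, (Commute.refl g).pow_left q |>.eq,
      Module.End.mul_apply, hw, map_add, hv]
    abel
  have hmod : ∀ n : ℕ, (g ^ (n % q)) u₀ = (g ^ n) u₀ := by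
    intro n
    have h : ∀ m : ℕ, ((g ^ q) ^ m) u₀ = u₀ := by
      intro m
      induction m with
      | zero => simp
      | succ m ih => rw [pow_succ, Module.End.mul_apply, hper, ih]
    conv_rhs => rw [← Nat.mod_add_div n q, pow_add, pow_mul, Module.End.mul_apply, h]
  have hu : ∀ j : ZMod q, u (j + 1) = g (u j) := by
    intro j
    have : (j + 1).val = (j.val + 1) % q := by
      rw [← ZMod.val_natCast]
      simp
    simp only [u]
    rw [this, hmod, pow_succ', Module.End.mul_apply]
  have hsum : ∑ j, u j = v := by
    have h1 : ∑ j, u j = ∑ i ∈ Finset.range q, (g ^ i) u₀ :=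
      Finset.sum_nbij' ZMod.val (fun i : ℕ => (i : ZMod q))
        (fun j _ => Finset.mem_range.2 (ZMod.val_lt j)) (fun _ _ => Finset.mem_univ _)
        (fun j _ => ZMod.natCast_zmod_val j)
        (fun i hi => ZMod.val_natCast_of_lt (Finset.mem_range.1 hi)) (fun _ _ => rfl)
    have h2 := LinearMap.congr_fun (geom_sum_mul g q) w
    simp only [Module.End.mul_apply, LinearMap.sub_apply, Module.End.one_apply,
      LinearMap.sum_apply, hw] at h2
    rw [h1, h2]
    abel
  have hshift : MvPolynomial.rename (fun j => j + 1) (pullback u f) = pullback u f := by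
    have h : ((MvPolynomial.rename fun j => j + 1).comp (pullback u)).comp (substEnd g) =
        pullback (K := K) u := by
      refine polyRing_algHom_ext fun l => ?_
      simp only [AlgHom.comp_apply, substEnd_ι,
        pullback_ι, map_sum, map_smul, MvPolynomial.rename_X, LinearMap.comp_apply, ← hu]
      exact Equiv.sum_comp (Equiv.addRight (1 : ZMod q))
        fun j => l (u j) • (MvPolynomial.X j : MvPolynomial (ZMod q) K)
    have := AlgHom.congr_fun h f
    rwa [AlgHom.comp_apply, AlgHom.comp_apply, hf] at this
  -- `g^q` fixes every `u j` and sends `w` to w + Σ u_j, so the invariant `f` has equal derivatives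
  -- in these two directions.
  have hD : ∑ j, MvPolynomial.pderiv j (pullback u f) = 0 := by
    have h : (pullbackDeform u w).comp (substEnd (g ^ q)) =
        pullbackDeform (K := K) u (w + ∑ j, u j) := by
      refine polyRing_algHom_ext fun l => ?_
      have hgu : ∀ j, (g ^ q) (u j) = u j := by
        intro j
        simp only [u]
        rw [← Module.End.mul_apply, (Commute.refl g).pow_pow q _ |>.eq, Module.End.mul_apply, hper]
      simp only [AlgHom.comp_apply, substEnd_ι,
        pullbackDeform_ι, pullback_ι, LinearMap.comp_apply, hgu, hw, hsum]
    have h1 := AlgHom.congr_fun h f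
    rw [AlgHom.comp_apply, substEnd_pow_apply hf] at h1
    have h2 := pullbackDeform_add_sum u w f
    rwa [← h1, left_eq_add] at h2
  rw [← hsum, coeff_lineEval_eq]
  refine aeval_one_eq_zero_of_shift_invariant (p := p) b _ ?_ ?_
    (MvPolynomial.homogeneousComponent_isHomogeneous _ _)
  · rw [MvPolynomial.rename_homogeneousComponent, hshift]
  · ext d
    have h := congrArg (MvPolynomial.coeff d) hD
    simp only [MvPolynomial.coeff_sum, MvPolynomial.coeff_pderiv,
      MvPolynomial.coeff_homogeneousComponent, map_add, Finsupp.degree_single,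
      MvPolynomial.coeff_zero] at h ⊢
    split_ifs
    · exact h
    · simp

end FixedVectors

/-! ### Taylor expansion along fixed vectors -/

section Translation

variable {K V I : Type*} [Field K] [AddCommGroup V] [Module K V] [Fintype I]

/-- The Taylor expansion of polynomial functions in the directions of the vectors `v i`. -/
noncomputable def translate (v : I → V) : PolyRing K V →ₐ[K] MvPolynomial I (PolyRing K V) :=
  SymmetricAlgebra.lift
    ((Algebra.linearMap (PolyRing K V) (MvPolynomial I (PolyRing K V))).restrictScalars K ∘ₗ
      SymmetricAlgebra.ι K (Dual K V) +
      ∑ i, LinearMap.toSpanSingleton K _ (MvPolynomial.X i) ∘ₗ Dual.eval K V (v i))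

lemma translate_ι (v : I → V) (l : Dual K V) :
    translate v (SymmetricAlgebra.ι K (Dual K V) l) =
      MvPolynomial.C (SymmetricAlgebra.ι K (Dual K V) l) +
        ∑ i, l (v i) • (MvPolynomial.X i : MvPolynomial I (PolyRing K V)) := by
  rw [translate, SymmetricAlgebra.lift_ι_apply, LinearMap.add_apply, LinearMap.sum_apply]
  rfl

lemma translate_substEnd {v : I → V} {g : V →ₗ[K] V} (hg : ∀ i, g (v i) = v i)
    (f : PolyRing K V) :
    translate v (substEnd g f) = MvPolynomial.mapAlgHom (substEnd g) (translate v f) := by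
  have : (translate v).comp (substEnd g) =
      (MvPolynomial.mapAlgHom (substEnd g)).comp (translate v) := by
    refine polyRing_algHom_ext fun l => ?_
    simp only [AlgHom.comp_apply, substEnd_ι, translate_ι, map_add, map_sum, map_smul,
      MvPolynomial.mapAlgHom_apply, MvPolynomial.map_C, MvPolynomial.map_X, LinearMap.comp_apply,
      hg, RingHom.coe_coe]
  exact AlgHom.congr_fun this f

lemma substEnd_coeff_translate {v : I → V} {g : V →ₗ[K] V} (hg : ∀ i, g (v i) = v i)
    {f : PolyRing K V} (hf : substEnd g f = f) (m : I →₀ ℕ) :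
    substEnd g ((translate v f).coeff m) = (translate v f).coeff m := by
  have h := congrArg (MvPolynomial.coeff m) (translate_substEnd hg f)
  rw [hf, MvPolynomial.mapAlgHom_apply, MvPolynomial.coeff_map] at h
  exact h.symm

lemma mapAlgHom_algebraMapInv_translate (v : I → V) (f : PolyRing K V) :
    MvPolynomial.mapAlgHom SymmetricAlgebra.algebraMapInv (translate v f) = pullback v f := by
  have : (MvPolynomial.mapAlgHom SymmetricAlgebra.algebraMapInv).comp (translate v) =
      pullback (K := K) v := by
    refine polyRing_algHom_ext fun l => ?_
    simp only [AlgHom.comp_apply, translate_ι, pullback_ι, map_add, map_sum, map_smul,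
      MvPolynomial.mapAlgHom_apply, MvPolynomial.map_C, MvPolynomial.map_X, RingHom.coe_coe,
      SymmetricAlgebra.algebraMapInv_ι, map_zero, zero_add]
  exact AlgHom.congr_fun this f

lemma algebraMapInv_coeff_translate (v : I → V) (f : PolyRing K V) (m : I →₀ ℕ) :
    SymmetricAlgebra.algebraMapInv ((translate v f).coeff m) = (pullback v f).coeff m := by
  rw [← mapAlgHom_algebraMapInv_translate, MvPolynomial.mapAlgHom_apply, MvPolynomial.coeff_map]
  rfl

lemma coeff_zero_pullback (v : I → V) (f : PolyRing K V) :
    (pullback v f).coeff 0 = SymmetricAlgebra.algebraMapInv f := by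
  have : (MvPolynomial.aeval fun _ : I => (0 : K)).comp (pullback v) =
      SymmetricAlgebra.algebraMapInv := by
    refine polyRing_algHom_ext fun l => ?_
    simp [pullback_ι, SymmetricAlgebra.algebraMapInv_ι]
  rw [← this, AlgHom.comp_apply, ← MvPolynomial.constantCoeff_eq, MvPolynomial.aeval_zero']
  rfl

/-- The Taylor expansion of a polynomial in the direction of the `i`-th variable. -/
noncomputable def taylorAt (K : Type*) [Field K] {I : Type*} [DecidableEq I] (i : I) :
    MvPolynomial I K →ₐ[K] MvPolynomial I (Polynomial K) :=
  MvPolynomial.aeval fun j =>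
    MvPolynomial.X j + if j = i then MvPolynomial.C Polynomial.X else 0

lemma coeff_coeff_taylorAt [DecidableEq I] (i : I) (P : MvPolynomial I K) (m : I →₀ ℕ) (n : ℕ) :
    ((taylorAt K i P).coeff m).coeff n =
      ((m i + n).choose n : K) * P.coeff (m + Finsupp.single i n) := by
  induction P using MvPolynomial.induction_on' with
  | add P Q hP hQ => simp only [map_add, MvPolynomial.coeff_add, Polynomial.coeff_add, hP, hQ,
      mul_add]
  | monomial d c =>
    have h1 : taylorAt K i (MvPolynomial.monomial d c) =
        ∑ k ∈ Finset.range (d i + 1), MvPolynomial.monomial (d.erase i + Finsupp.single i k)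
          (Polynomial.C c * (Polynomial.X ^ (d i - k) * ((d i).choose k : Polynomial K))) := by
      rw [taylorAt, MvPolynomial.aeval_monomial, Finsupp.prod_fintype _ _ (by simp),
        ← Finset.mul_prod_erase _ _ (Finset.mem_univ i), if_pos rfl, add_pow]
      have h2 : ∏ j ∈ Finset.univ.erase i, ((MvPolynomial.X j : MvPolynomial I (Polynomial K)) +
          if j = i then MvPolynomial.C Polynomial.X else 0) ^ d j =
          MvPolynomial.monomial (d.erase i) 1 := by
        rw [MvPolynomial.monomial_eq, Finsupp.prod_fintype _ _ (by simp),
          ← Finset.mul_prod_erase _ _ (Finset.mem_univ i), Finsupp.erase_same, pow_zero, one_mul,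
          MvPolynomial.C_1, one_mul]
        refine Finset.prod_congr rfl fun j hj => ?_
        have hj' := Finset.ne_of_mem_erase hj
        rw [if_neg hj', add_zero, Finsupp.erase_ne hj']
      rw [h2, Finset.sum_mul, Finset.mul_sum]
      refine Finset.sum_congr rfl fun k _ => ?_
      have h3 : ∀ (s : I →₀ ℕ) (r : Polynomial K), MvPolynomial.monomial s r =
          MvPolynomial.C r * MvPolynomial.monomial s 1 := fun s r => by
        rw [MvPolynomial.C_mul_monomial, mul_one]
      have h4 : (MvPolynomial.monomial (d.erase i + Finsupp.single i k) 1 :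
          MvPolynomial I (Polynomial K)) = MvPolynomial.monomial (d.erase i) 1 *
            MvPolynomial.X i ^ k := by
        rw [MvPolynomial.X_pow_eq_monomial, MvPolynomial.monomial_mul, mul_one]
      rw [h3 (d.erase i + _), h4,
        IsScalarTower.algebraMap_apply K (Polynomial K) (MvPolynomial I (Polynomial K)),
        MvPolynomial.algebraMap_eq, Polynomial.algebraMap_eq]
      simp only [map_mul, map_pow, map_natCast]
      ring
    have h5 : ∀ k, (Polynomial.C c * (Polynomial.X ^ (d i - k) *
        ((d i).choose k : Polynomial K))).coeff n =
        if n = d i - k then c * ((d i).choose k : K) else 0 := by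
      intro k
      rw [Polynomial.coeff_C_mul, ← Polynomial.C_eq_natCast, Polynomial.coeff_mul_C,
        Polynomial.coeff_X_pow]
      split_ifs <;> simp
    have h6 : ∀ k ≤ d i, d.erase i + Finsupp.single i k = m →
        d = m + Finsupp.single i (d i - k) := by
      intro k hk h
      rw [← h, add_assoc, ← Finsupp.single_add, Nat.add_sub_cancel' hk, Finsupp.erase_add_single]
    rw [h1, MvPolynomial.coeff_sum, Polynomial.finsetSum_coeff]
    simp only [MvPolynomial.coeff_monomial, apply_ite (fun P : Polynomial K => P.coeff n), h5,
      Polynomial.coeff_zero]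
    by_cases hd : d = m + Finsupp.single i n
    · have hdi : d i = m i + n := by simp [hd]
      have her : d.erase i + Finsupp.single i (m i) = m := by
        rw [hd, Finsupp.erase_add, Finsupp.erase_single, add_zero, Finsupp.erase_add_single]
      rw [Finset.sum_eq_single (m i), if_pos her, if_pos (by omega), if_pos hd, hdi,
        Nat.choose_symm_add, mul_comm]
      · intro k _ hk
        rw [if_neg]
        intro h
        apply hk
        rw [← h]
        simp
      · intro h
        exact absurd (Finset.mem_range.2 (by omega)) h
    · rw [if_neg hd, mul_zero]
      refine Finset.sum_eq_zero fun k hk => ?_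
      split_ifs with h h'
      · exact absurd (h' ▸ h6 k (Nat.lt_succ_iff.1 (Finset.mem_range.1 hk)) h) hd
      · rfl
      · rfl

/-- Both sides are the coefficient of t^m s^n in f(Σ t_j v_j + s v_i). -/
lemma coeff_lineEval_coeff_translate [DecidableEq I] (v : I → V) (f : PolyRing K V) (i : I)
    (m : I →₀ ℕ) (n : ℕ) :
    (lineEval (v i) ((translate v f).coeff m)).coeff n =
      ((m i + n).choose n : K) * (pullback v f).coeff (m + Finsupp.single i n) := by
  rw [← coeff_coeff_taylorAt]
  have : (MvPolynomial.mapAlgHom (lineEval (v i))).comp (translate v) =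
      (taylorAt K i).comp (pullback v) := by
    refine polyRing_algHom_ext fun l => ?_
    simp only [AlgHom.comp_apply, translate_ι, pullback_ι, map_add, map_sum, map_smul,
      MvPolynomial.mapAlgHom_apply, MvPolynomial.map_C, MvPolynomial.map_X, RingHom.coe_coe,
      lineEval_ι, taylorAt, MvPolynomial.aeval_X, smul_add, Finset.sum_add_distrib, smul_ite,
      smul_zero, Finset.sum_ite_eq', Finset.mem_univ, if_true]
    rw [add_comm]
    congr 1
    rw [Algebra.smul_def, Algebra.smul_def, map_mul,
      IsScalarTower.algebraMap_apply K (Polynomial K) (MvPolynomial I (Polynomial K)),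
      MvPolynomial.algebraMap_eq]
  have h := congrArg (MvPolynomial.coeff m) (AlgHom.congr_fun this f)
  rw [AlgHom.comp_apply, AlgHom.comp_apply, MvPolynomial.mapAlgHom_apply,
    MvPolynomial.coeff_map] at h
  rw [← h]
  rfl

end Translation

/-! ### Exponents of invariants along the fixed vectors -/

section Coefficients

variable {p : ℕ} [Fact p.Prime] {K V I : Type*} [Field K] [CharP K p] [AddCommGroup V] [Module K V]
  [Fintype I]

/-- Lucas's congruence removes one factor p at a time. -/
lemma choose_pow_mul_modEq (b u : ℕ) : (p ^ b * u).choose (p ^ b) ≡ u [MOD p] := by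
  have hp : 0 < p := (Fact.out : p.Prime).pos
  induction b with
  | zero => simp [Nat.ModEq.refl]
  | succ b ih =>
    have h := Choose.choose_modEq_choose_mod_mul_choose_div_nat
      (n := p ^ (b + 1) * u) (k := p ^ (b + 1)) (p := p)
    rw [pow_succ', mul_assoc, Nat.mul_mod_right, Nat.mul_mod_right, Nat.mul_div_cancel_left _ hp,
      Nat.mul_div_cancel_left _ hp, Nat.choose_self, one_mul] at h
    rw [pow_succ', mul_assoc]
    exact h.trans ih

/-- An exponent of an invariant along the fixed vectors `v i` that is not divisible by `p ^ a i`
does not occur. -/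
theorem coeff_pullback_eq_zero {g : V →ₗ[K] V} {v : I → V} (hg : ∀ i, g (v i) = v i) {a : I → ℕ}
    (hw : ∀ i, ∀ b < a i, ∃ w, (g ^ p ^ b) w = w + v i)
    {f : PolyRing K V} (hf : substEnd g f = f) {m : I →₀ ℕ} {i : I} (hm : ¬ p ^ a i ∣ m i) :
    (pullback v f).coeff m = 0 := by
  classical
  have hp : p.Prime := Fact.out
  have hm0 : m i ≠ 0 := fun h => hm (h ▸ dvd_zero _)
  obtain ⟨b, u, hu, hbu⟩ := Nat.exists_eq_pow_mul_and_not_dvd hm0 p hp.ne_one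
  have hb : b < a i := by
    by_contra h
    exact hm (hbu ▸ (pow_dvd_pow p (not_lt.1 h)).mul_right u)
  have hle : p ^ b ≤ m i := by
    rw [hbu]
    exact Nat.le_mul_of_pos_right _ (Nat.pos_of_ne_zero fun h => hu (h ▸ dvd_zero p))
  -- The Taylor coefficient at `m'` is itself invariant, so it has no term of degree p^b along `v
  -- i`. That term is the wanted coefficient times a binomial congruent to u, a unit mod p.
  set m' := m - Finsupp.single i (p ^ b) with hm'
  have hmm : m' + Finsupp.single i (p ^ b) = m :=
    tsub_add_cancel_of_le (Finsupp.single_le_iff.2 hle)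
  have hmi : m' i + p ^ b = p ^ b * u := by
    rw [← hbu, ← hmm]
    simp
  obtain ⟨w, hw⟩ := hw i b hb
  have h := coeff_lineEval_eq_zero (p := p) (substEnd_coeff_translate hg hf m') b hw (hg i)
  rw [coeff_lineEval_coeff_translate, hmm, hmi] at h
  refine (mul_eq_zero.1 h).resolve_left fun h0 => hu ?_
  rw [CharP.cast_eq_zero_iff K p] at h0
  exact (Nat.ModEq.dvd_iff (choose_pow_mul_modEq b u) dvd_rfl).1 h0

end Coefficients

lemma pow_eq_zero_of_neg_pow {R : Type*} [CommRing R] {a : R} {n : ℕ} (h : (-a) ^ n = 0) :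
    a ^ n = 0 := by
  rw [neg_pow] at h
  rcases neg_one_pow_eq_or R n with h' | h' <;> rw [h'] at h <;> simpa using h

lemma neg_pow_eq_zero {R : Type*} [CommRing R] {a : R} {n : ℕ} (h : a ^ n = 0) :
    (-a) ^ n = 0 := by
  rw [neg_pow, h, mul_zero]

lemma sum_smul_of_dual {K V I B : Type*} [Field K] [AddCommGroup V] [Module K V] [Fintype I]
    [AddCommMonoid B] [Module K B] {v : I → V} {y : I → Dual K V}
    (hy : ∀ i, y i (v i) = 1) (hy' : ∀ i j, i ≠ j → y i (v j) = 0) (b : I → B) (i : I) :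
    ∑ j, y i (v j) • b j = b i := by
  rw [Fintype.sum_eq_single i fun j hj => by rw [hy' i j hj.symm, zero_smul], hy, one_smul]

universe u in
lemma exists_quotient {K : Type*} {C : Type u} [CommRing K] [CommRing C] [Algebra K C] (S : Set C) :
    ∃ (Q : Type u) (_ : CommRing Q) (_ : Algebra K Q) (π : C →ₐ[K] Q),
      Function.Surjective π ∧ (∀ a ∈ S, π a = 0) ∧
      ∀ s : C →ₐ[K] C, (∀ a ∈ S, s a = 0) → ∃ s' : Q →ₐ[K] C, ∀ c, s' (π c) = s c :=
  ⟨C ⧸ Ideal.span S, inferInstance, inferInstance, Ideal.Quotient.mkₐ K _,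
    Ideal.Quotient.mkₐ_surjective K _,
    fun _ ha => Ideal.Quotient.eq_zero_iff_mem.2 (Ideal.subset_span ha),
    fun s hs => ⟨Ideal.Quotient.liftₐ _ s fun _ ha =>
      (Ideal.span_le.2 hs : Ideal.span S ≤ RingHom.ker s) ha, fun _ => rfl⟩⟩

/-! ### Translations and nilpotency in the coinvariants -/

section Coinvariants

variable {K G V : Type*} [Field K] [Group G] [AddCommGroup V] [Module K V]
  {ρ : Representation K G V}

lemma polyAct_eq_substEnd (h : G) : polyAct ρ h = substEnd (ρ h⁻¹) := rfl

lemma polyAct_eq_self_of_generator [Finite G] {σ : G} (hσ : ∀ h : G, h ∈ Subgroup.zpowers σ)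
    {f : PolyRing K V} (hf : substEnd (ρ σ⁻¹) f = f) (h : G) : polyAct ρ h f = f := by
  have h1 : h⁻¹ ∈ Subgroup.zpowers σ⁻¹ := by
    rw [Subgroup.zpowers_inv]
    exact hσ _
  rw [← (isOfFinOrder_of_finite σ⁻¹).mem_powers_iff_mem_zpowers] at h1
  obtain ⟨n, hn⟩ := h1
  rw [polyAct_eq_substEnd, ← hn]
  simp only [map_pow]
  exact substEnd_pow_apply hf n

lemma mem_hilbertIdeal {f : PolyRing K V} (hf : ∀ h, polyAct ρ h f = f)
    (h0 : SymmetricAlgebra.algebraMapInv f = 0) : f ∈ hilbertIdeal ρ :=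
  Ideal.subset_span ⟨hf, h0⟩

lemma coinv_algHom_ext {A : Type*} [CommRing A] [Algebra K A] {F H : Coinv ρ →ₐ[K] A}
    (h : ∀ l, F (linImage ρ l) = H (linImage ρ l)) : F = H :=
  Ideal.Quotient.algHom_ext _ (polyRing_algHom_ext h)

/-- The augmentation of the algebra of coinvariants. -/
noncomputable def coinvAugmentation (ρ : Representation K G V) : Coinv ρ →ₐ[K] K :=
  Ideal.Quotient.liftₐ _ SymmetricAlgebra.algebraMapInv fun f hf => by
    have : hilbertIdeal ρ ≤ RingHom.ker (SymmetricAlgebra.algebraMapInv (R := K) (M := Dual K V)) :=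
      Ideal.span_le.2 fun f hf => hf.2
    exact this hf

lemma coinvAugmentation_linImage (l : Dual K V) : coinvAugmentation ρ (linImage ρ l) = 0 :=
  SymmetricAlgebra.algebraMapInv_ι l

/-- Taylor expansion descends to the coinvariants as soon as the increments are nilpotent of
the right order. -/
theorem exists_coinv_translate {I : Type*} [Fintype I] {v : I → V} {q : I → ℕ}
    (hv : ∀ h i, ρ h (v i) = v i)
    (hcoeff : ∀ f, (∀ h, polyAct ρ h f = f) → ∀ m : I →₀ ℕ, m ≠ 0 → (∀ i, m i < q i) →
      (pullback v f).coeff m = 0)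
    {B : Type*} [CommRing B] [Algebra K B] (c : Coinv ρ →ₐ[K] B) (b : I → B)
    (hb : ∀ i, b i ^ q i = 0) :
    ∃ Φ : Coinv ρ →ₐ[K] B, ∀ l, Φ (linImage ρ l) = c (linImage ρ l) + ∑ i, l (v i) • b i := by
  let c' : PolyRing K V →ₐ[K] B := c.comp (Ideal.Quotient.mkₐ K (hilbertIdeal ρ))
  let Φ : PolyRing K V →ₐ[K] B :=
    (((MvPolynomial.aeval b : MvPolynomial I B →ₐ[B] B).restrictScalars K).comp
      (MvPolynomial.mapAlgHom c')).comp (translate v)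
  have hΦ : ∀ l, Φ (SymmetricAlgebra.ι K (Dual K V) l) =
      c (linImage ρ l) + ∑ i, l (v i) • b i := by
    intro l
    simp only [Φ, AlgHom.comp_apply, translate_ι, map_add, map_sum, map_smul,
      MvPolynomial.mapAlgHom_apply, MvPolynomial.map_C, MvPolynomial.map_X,
      AlgHom.restrictScalars_apply, MvPolynomial.aeval_X, MvPolynomial.aeval_C]
    rfl
  have hker : hilbertIdeal ρ ≤ RingHom.ker Φ := by
    refine Ideal.span_le.2 ?_
    rintro f ⟨hf, hf0⟩
    change MvPolynomial.aeval b (MvPolynomial.mapAlgHom c' (translate v f)) = 0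
    rw [MvPolynomial.aeval_def, MvPolynomial.eval₂_eq']
    refine Finset.sum_eq_zero fun m _ => ?_
    -- Small exponents have their Taylor coefficient in the Hilbert ideal; for the others the
    -- monomial in `b` vanishes.
    by_cases hm : ∀ i, m i < q i
    · have hmem : (translate v f).coeff m ∈ hilbertIdeal ρ := by
        refine mem_hilbertIdeal (fun h => ?_) ?_
        · rw [polyAct_eq_substEnd]
          exact substEnd_coeff_translate (fun i => hv _ i) (hf h) m
        · rw [algebraMapInv_coeff_translate]
          by_cases hm0 : m = 0
          · rw [hm0, coeff_zero_pullback, hf0]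
          · exact hcoeff f hf m hm0 hm
      have h0 : c' ((translate v f).coeff m) = 0 := by
        have : Ideal.Quotient.mkₐ K (hilbertIdeal ρ) ((translate v f).coeff m) = 0 :=
          Ideal.Quotient.eq_zero_iff_mem.2 hmem
        rw [AlgHom.comp_apply, this, map_zero]
      rw [MvPolynomial.mapAlgHom_apply, MvPolynomial.coeff_map]
      change algebraMap B B (c' _) * _ = 0
      rw [h0, map_zero, zero_mul]
    · push Not at hm
      obtain ⟨i, hi⟩ := hm
      rw [Finset.prod_eq_zero (Finset.mem_univ i), mul_zero]
      exact pow_eq_zero_of_le hi (hb i)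
  exact ⟨Ideal.Quotient.liftₐ _ Φ fun f hf => hker hf, hΦ⟩

theorem linImage_pow_eq_zero {g : V →ₗ[K] V}
    (hg : ∀ f : PolyRing K V, substEnd g f = f → ∀ h, polyAct ρ h f = f)
    {y : Dual K V} {q : ℕ} (hq : 0 < q) (hy : y ∘ₗ (g ^ q) = y) : linImage ρ y ^ q = 0 := by
  set ι := SymmetricAlgebra.ι K (Dual K V) with hι
  let P : Polynomial (PolyRing K V) :=
    ∏ j ∈ Finset.range q, (Polynomial.X + Polynomial.C (ι (y ∘ₗ (g ^ j))))
  have hPmap : P.map (substEnd g : PolyRing K V →+* PolyRing K V) = P := by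
    simp only [P, Polynomial.map_prod, Polynomial.map_add, Polynomial.map_X, Polynomial.map_C,
      RingHom.coe_coe, hι, substEnd_ι, LinearMap.comp_assoc]
    have h1 : ∀ j : ℕ, (g ^ j) ∘ₗ g = g ^ (j + 1) := fun j =>
      (pow_succ (M := Module.End K V) g j).symm
    simp only [h1]
    -- Applying `g` moves factor j to j + 1; the new last factor is the old factor 0 by `hy`.
    obtain ⟨q, rfl⟩ := Nat.exists_eq_succ_of_ne_zero hq.ne'
    rw [Finset.prod_range_succ, Finset.prod_range_succ']
    rw [hy]
    congr 3
  have hPinv : ∀ m, ∀ h, polyAct ρ h (P.coeff m) = P.coeff m := by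
    intro m
    refine hg _ ?_
    have := congrArg (fun Q => Polynomial.coeff Q m) hPmap
    rw [Polynomial.coeff_map] at this
    exact this
  have hP0 : P.map (SymmetricAlgebra.algebraMapInv : PolyRing K V →ₐ[K] K).toRingHom =
      Polynomial.X ^ q := by
    simp only [P, Polynomial.map_prod, Polynomial.map_add, Polynomial.map_X, Polynomial.map_C]
    have h1 : ∀ l, (SymmetricAlgebra.algebraMapInv : PolyRing K V →ₐ[K] K).toRingHom (ι l) = 0 :=
      SymmetricAlgebra.algebraMapInv_ι
    simp only [h1, map_zero, add_zero, Finset.prod_const, Finset.card_range]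
  have hmonic : P.Monic := Polynomial.monic_prod_of_monic _ _ fun j _ => Polynomial.monic_X_add_C _
  have hdeg : P.natDegree = q := by
    rw [Polynomial.natDegree_prod_of_monic _ _ fun j _ => Polynomial.monic_X_add_C _]
    simp
  have hbar : P.map (Ideal.Quotient.mk (hilbertIdeal ρ)) = Polynomial.X ^ q := by
    ext m
    rw [Polynomial.coeff_map, Polynomial.coeff_X_pow]
    split_ifs with hm
    · rw [hm, ← hdeg, hmonic.coeff_natDegree, map_one]
    · refine Ideal.Quotient.eq_zero_iff_mem.2 (mem_hilbertIdeal (hPinv m) ?_)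
      have := congrArg (fun Q => Polynomial.coeff Q m) hP0
      simp only [Polynomial.coeff_map, Polynomial.coeff_X_pow, if_neg hm] at this
      exact this
  have heval : (P.map (Ideal.Quotient.mk (hilbertIdeal ρ))).eval (-linImage ρ y) = 0 := by
    simp only [P, Polynomial.map_prod, Polynomial.eval_prod]
    refine Finset.prod_eq_zero (Finset.mem_range.2 hq) ?_
    simp only [Polynomial.map_add, Polynomial.map_X, Polynomial.map_C, Polynomial.eval_add,
      Polynomial.eval_X, Polynomial.eval_C, pow_zero]
    exact neg_add_cancel _
  rw [hbar, Polynomial.eval_pow, Polynomial.eval_X] at heval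
  exact pow_eq_zero_of_neg_pow heval

end Coinvariants

/-! ### Freeness from a translation -/

section Freeness

open scoped TensorProduct

variable {K P C Q L I : Type*} [Field K] [CommRing P] [Algebra K P] [CommRing C] [Algebra K C]
  [CommRing Q] [Algebra K Q] [Fintype I]

/-- `α` translates forward by t_i and `s` translates back, so `α` and a ⊗ b ↦ ψ(a) s(b) are mutually
inverse. Thus C ≅ P ⊗ Q over P, and Q is free over the field K. -/
theorem free_of_translation (S : Subalgebra K C) (E : P ≃ₐ[K] S) (ψ : P →ₐ[K] C)
    (hE : ∀ a, (E a : C) = ψ a) (x : L → C)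
    (hx : ∀ F H : C →ₐ[K] C, (∀ l, F (x l) = H (x l)) → F = H)
    (hx' : ∀ F H : C →ₐ[K] P ⊗[K] Q, (∀ l, F (x l) = H (x l)) → F = H)
    (t : I → P) (ht : ∀ F H : P →ₐ[K] P ⊗[K] Q, (∀ i, F (t i) = H (t i)) → F = H)
    (y : I → L) (c : L → I → K) (hψ : ∀ i, ψ (t i) = x (y i))
    {π : C →ₐ[K] Q} (hπ : Function.Surjective π) (s : Q →ₐ[K] C) (α : C →ₐ[K] P ⊗[K] Q)
    (hs : ∀ l, s (π (x l)) = x l + ∑ i, -(c l i • ψ (t i)))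
    (hα : ∀ l, α (x l) = (1 : P) ⊗ₜ π (x l) + ∑ i, c l i • (t i ⊗ₜ[K] (1 : Q)))
    (hπy : ∀ i, π (x (y i)) = 0)
    (hc : ∀ (b : I → P ⊗[K] Q) i, ∑ j, c (y i) j • b j = b i) :
    Module.Free S C := by
  let β : P ⊗[K] Q →ₐ[K] C := Algebra.TensorProduct.lift ψ s fun _ _ => Commute.all _ _
  have hβ : ∀ a b, β (a ⊗ₜ b) = ψ a * s b := fun a b => Algebra.TensorProduct.lift_tmul _ _ _ _ _
  have hβα : β.comp α = AlgHom.id K _ := by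
    refine hx _ _ fun l => ?_
    rw [AlgHom.comp_apply, hα, map_add, map_sum]
    simp only [map_smul, hβ, map_one, one_mul, mul_one, hs, Finset.sum_neg_distrib,
      neg_add_cancel_right, AlgHom.id_apply]
  have hαt : ∀ i, α (ψ (t i)) = t i ⊗ₜ 1 := fun i => by
    rw [hψ, hα, hπy, TensorProduct.tmul_zero, zero_add, hc fun i => t i ⊗ₜ[K] (1 : Q)]
  have hαβ : α.comp β = AlgHom.id K _ := by
    refine Algebra.TensorProduct.ext' fun a b => ?_
    have h1 : α.comp ψ = Algebra.TensorProduct.includeLeft :=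
      ht _ _ hαt
    have h2 : α.comp s = Algebra.TensorProduct.includeRight := by
      rw [← AlgHom.cancel_right hπ]
      refine hx' _ _ fun l => ?_
      simp only [AlgHom.comp_apply, hs, map_add, map_sum, map_neg, map_smul, hα, hαt,
        Finset.sum_neg_distrib, add_neg_cancel_right, Algebra.TensorProduct.includeRight_apply]
    rw [AlgHom.comp_apply, hβ, map_mul, ← AlgHom.comp_apply, ← AlgHom.comp_apply α, h1, h2]
    simp
  let A : P ⊗[K] Q ≃ₐ[K] C := AlgEquiv.ofAlgHom β α hβα hαβ
  let σ₁ : P →+* S := E.toRingEquiv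
  let σ₂ : S →+* P := E.symm.toRingEquiv
  have : RingHomInvPair σ₁ σ₂ := RingHomInvPair.of_ringEquiv E.toRingEquiv
  have : RingHomInvPair σ₂ σ₁ := RingHomInvPair.symm σ₁ σ₂
  let A' : (P ⊗[K] Q) ≃ₛₗ[σ₁] C :=
    { A.toAddEquiv with
      map_smul' := fun a z => by
        have h : β (a • z) = ψ a * β z := by
          induction z using TensorProduct.induction_on with
          | zero => simp
          | tmul b d => rw [TensorProduct.smul_tmul', hβ, hβ, smul_eq_mul, map_mul, mul_assoc]
          | add z w hz hw => rw [smul_add, map_add, map_add, hz, hw, mul_add]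
        exact h.trans (congrArg (· * β z) (hE a).symm) }
  exact Module.Free.of_equiv A'

end Freeness

/-! ### The truncated polynomial subalgebra -/

section Structure

variable {K G V : Type*} [Field K] [Group G] [AddCommGroup V] [Module K V]
  {ρ : Representation K G V} {I : Type*}

/-- The truncated polynomial algebra. -/
abbrev TruncatedPoly (K : Type*) [Field K] {I : Type*} (q : I → ℕ) : Type _ :=
  MvPolynomial I K ⧸ Ideal.span (Set.range fun i => (MvPolynomial.X i : MvPolynomial I K) ^ q i)

/-- The class of a variable in the truncated polynomial algebra. -/
noncomputable def truncatedVar (K : Type*) [Field K] {I : Type*} (q : I → ℕ) (i : I) :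
    TruncatedPoly K q :=
  Ideal.Quotient.mk _ (MvPolynomial.X i)

lemma truncatedVar_pow (q : I → ℕ) (i : I) : truncatedVar K q i ^ q i = 0 := by
  rw [truncatedVar, ← map_pow]
  exact Ideal.Quotient.eq_zero_iff_mem.2 (Ideal.subset_span ⟨i, rfl⟩)

lemma exists_truncatedPoly_lift {q : I → ℕ} {B : Type*} [CommRing B] [Algebra K B] (b : I → B)
    (hb : ∀ i, b i ^ q i = 0) :
    ∃ ψ : TruncatedPoly K q →ₐ[K] B, ∀ i, ψ (truncatedVar K q i) = b i := by
  have hker : Ideal.span (Set.range fun i => (MvPolynomial.X i : MvPolynomial I K) ^ q i) ≤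
      RingHom.ker (MvPolynomial.aeval b : MvPolynomial I K →ₐ[K] B) := by
    refine Ideal.span_le.2 ?_
    rintro _ ⟨i, rfl⟩
    change MvPolynomial.aeval b (MvPolynomial.X i ^ q i) = 0
    rw [map_pow, MvPolynomial.aeval_X, hb]
  exact ⟨Ideal.Quotient.liftₐ _ (MvPolynomial.aeval b) fun f hf => hker hf,
    fun i => MvPolynomial.aeval_X b i⟩

lemma truncatedPoly_algHom_ext {q : I → ℕ} {B : Type*} [CommRing B] [Algebra K B]
    {F H : TruncatedPoly K q →ₐ[K] B} (h : ∀ i, F (truncatedVar K q i) = H (truncatedVar K q i)) :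
    F = H :=
  Ideal.Quotient.algHom_ext _ (MvPolynomial.algHom_ext h)

-- Three translations are used: from the augmentation by t_i, a retraction of `ψ`, which makes `ψ`
-- injective; from the identity by -X_i, the map `s`; and from the quotient by (X_i), with
-- increments t_i ⊗ 1, the map `α`.
open scoped TensorProduct in
theorem linSubalgebra_structure [Fintype I] {v : I → V} {y : I → Dual K V} {q : I → ℕ}
    (hy : ∀ i, y i (v i) = 1) (hy' : ∀ i j, i ≠ j → y i (v j) = 0)
    (hpow : ∀ i, linImage ρ (y i) ^ q i = 0)
    (hv : ∀ h i, ρ h (v i) = v i)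
    (hcoeff : ∀ f, (∀ h, polyAct ρ h f = f) → ∀ m : I →₀ ℕ, m ≠ 0 → (∀ i, m i < q i) →
      (pullback v f).coeff m = 0) :
    (∃ φ : linSubalgebra ρ y ≃ₐ[K] TruncatedPoly K q,
      ∀ i, φ (linGen ρ y i) = truncatedVar K q i) ∧
    Module.Free (linSubalgebra ρ y) (Coinv ρ) := by
  classical
  obtain ⟨ψ, hψ⟩ := exists_truncatedPoly_lift (K := K) (fun i => linImage ρ (y i)) hpow
  obtain ⟨π, hπ⟩ := exists_coinv_translate hv hcoeff
    ((Algebra.ofId K (TruncatedPoly K q)).comp (coinvAugmentation ρ)) (truncatedVar K q)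
    (truncatedVar_pow q)
  have hπψ : π.comp ψ = AlgHom.id K _ := by
    refine truncatedPoly_algHom_ext fun i => ?_
    rw [AlgHom.comp_apply, hψ, hπ, AlgHom.comp_apply, coinvAugmentation_linImage, map_zero,
      zero_add, sum_smul_of_dual hy hy']
    rfl
  have hψinj : Function.Injective ψ := fun a b hab => by
    have := congrArg π hab
    rwa [← AlgHom.comp_apply, ← AlgHom.comp_apply, hπψ] at this
  have hrange : ψ.range = linSubalgebra ρ y := by
    have h1 : Algebra.adjoin K (Set.range (truncatedVar K q)) = ⊤ := by
      have h2 := congrArg (Subalgebra.map (Ideal.Quotient.mkₐ K (Ideal.span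
        (Set.range fun i => (MvPolynomial.X i : MvPolynomial I K) ^ q i))))
        (MvPolynomial.adjoin_range_X (R := K) (σ := I))
      rw [AlgHom.map_adjoin, ← Set.range_comp, Algebra.map_top,
        (AlgHom.range_eq_top _).2 (Ideal.Quotient.mkₐ_surjective K _)] at h2
      exact h2
    rw [← Algebra.map_top, ← h1, AlgHom.map_adjoin, ← Set.range_comp, linSubalgebra]
    congr 2
    ext1 i
    exact hψ i
  let E : TruncatedPoly K q ≃ₐ[K] linSubalgebra ρ y :=
    (AlgEquiv.ofInjective ψ hψinj).trans (Subalgebra.equivOfEq _ _ hrange)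
  have hE : ∀ a, (E a : Coinv ρ) = ψ a := fun a => rfl
  refine ⟨⟨E.symm, fun i => ?_⟩, ?_⟩
  · rw [AlgEquiv.symm_apply_eq]
    exact Subtype.ext (hψ i).symm
  · obtain ⟨Q, _, _, π₀, hπ₀surj, hπ₀', hlift⟩ :=
      exists_quotient (K := K) (Set.range fun i => linImage ρ (y i))
    have hπ₀ : ∀ i, π₀ (linImage ρ (y i)) = 0 := fun i => hπ₀' _ ⟨i, rfl⟩
    obtain ⟨s₀, hs₀⟩ := exists_coinv_translate hv hcoeff (AlgHom.id K (Coinv ρ))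
      (fun i => -linImage ρ (y i)) (fun i => neg_pow_eq_zero (hpow i))
    obtain ⟨s, hs⟩ := hlift s₀ (by
      rintro _ ⟨i, rfl⟩
      rw [hs₀, sum_smul_of_dual hy hy' (fun i => -linImage ρ (y i))]
      exact add_neg_cancel _)
    obtain ⟨α, hα⟩ := exists_coinv_translate hv hcoeff
      ((Algebra.TensorProduct.includeRight : Q →ₐ[K] TruncatedPoly K q ⊗[K] Q).comp π₀)
      (fun i => truncatedVar K q i ⊗ₜ[K] (1 : Q)) (fun i => by
        rw [Algebra.TensorProduct.tmul_pow, truncatedVar_pow, TensorProduct.zero_tmul])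
    refine free_of_translation _ E ψ hE (linImage ρ) (fun F H h => coinv_algHom_ext h)
      (fun F H h => coinv_algHom_ext h)
      (truncatedVar K q) (fun F H h => truncatedPoly_algHom_ext h) y (fun l i => l (v i)) hψ
      hπ₀surj s α (fun l => ?_) hα hπ₀ (fun b i => sum_smul_of_dual hy hy' b i)
    rw [hs, hs₀, AlgHom.id_apply]
    simp only [smul_neg, hψ]

end Structure

/-! ### Jordan blocks and terminal variables -/

section JordanBlocks

variable {K G V : Type*} [Field K] [Group G] [AddCommGroup V] [Module K V]
  {ρ : Representation K G V} {σ : G} {I : Type*} {n : I → ℕ}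
  {e : Basis (Σ i, Fin (n i)) K V}

lemma IsJordanBasis.sub_one_pow_apply (he : IsJordanBasis ρ σ e) (m : ℕ) (i : I) (j : Fin (n i)) :
    ((ρ σ⁻¹ - 1) ^ m) (e ⟨i, j⟩) =
      if h : j.1 + m < n i then e ⟨i, ⟨j.1 + m, h⟩⟩ else 0 := by
  induction m with
  | zero => simp
  | succ m ih =>
    rw [pow_succ', Module.End.mul_apply, ih]
    by_cases h : j.1 + m < n i
    · rw [dif_pos h, LinearMap.sub_apply, he, Module.End.one_apply, add_sub_cancel_left]
      rfl
    · rw [dif_neg h, map_zero, dif_neg (by omega)]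

/-- In characteristic p, (g - 1)^(p^b) = g^(p^b) - 1. -/
lemma IsJordanBasis.pow_apply {p : ℕ} [Fact p.Prime] [CharP K p] (he : IsJordanBasis ρ σ e)
    (b : ℕ) (i : I) (j : Fin (n i)) :
    ((ρ σ⁻¹) ^ p ^ b) (e ⟨i, j⟩) =
      e ⟨i, j⟩ + if h : j.1 + p ^ b < n i then e ⟨i, ⟨j.1 + p ^ b, h⟩⟩ else 0 := by
  have : Nontrivial V := nontrivial_of_ne _ _ (e.ne_zero ⟨i, j⟩)
  have : CharP (Module.End K V) p :=
    charP_of_injective_algebraMap (algebraMap K (Module.End K V)).injective p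
  rw [← he.sub_one_pow_apply, sub_pow_char_pow_of_commute p b (Commute.one_right _), one_pow,
    LinearMap.sub_apply, Module.End.one_apply, add_sub_cancel]

/-- G acts on the quotient line by a scalar c with c^(p^r) = 1, and (c - 1)^(p^r) = 0 forces c = 1.
-/
lemma IsTerminal.coord_dual {p r : ℕ} [Fact p.Prime] [CharP K p] (hcard : Nat.card G = p ^ r)
    {J : Type*} {x : Basis J K (Dual K V)} {i : J} (hx : IsTerminal ρ x i) (g : G)
    (l : Dual K V) : x.coord i (ρ.dual g l) = x.coord i l := by
  have hmem : ∀ l, x.coord i l = 0 → x.coord i (ρ.dual g l) = 0 := by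
    have h : ∀ l, l ∈ Submodule.span K (x '' {j | j ≠ i}) ↔ x.coord i l = 0 := by
      intro l
      rw [Basis.mem_span_image, Basis.coord_apply, ← Finsupp.notMem_support_iff]
      constructor
      · exact fun h h' => h h' rfl
      · rintro h j hj rfl
        exact h hj
    intro l hl
    exact (h _).1 (hx g l ((h l).2 hl))
  set c := x.coord i (ρ.dual g (x i)) with hc
  have hmul : ∀ l, x.coord i (ρ.dual g l) = c * x.coord i l := by
    intro l
    have h := hmem (l - x.coord i l • x i) (by simp)
    rw [map_sub, map_sub, map_smul, map_smul, sub_eq_zero, smul_eq_mul] at h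
    rw [h, mul_comm]
  have hpow : ∀ (m : ℕ) l, x.coord i (ρ.dual (g ^ m) l) = c ^ m * x.coord i l := by
    intro m
    induction m with
    | zero =>
      intro l
      rw [pow_zero, pow_zero, one_mul, map_one, Module.End.one_apply]
    | succ m ih =>
      intro l
      rw [pow_succ, map_mul, Module.End.mul_apply, ih, hmul]
      ring
  have hc1 : c ^ p ^ r = 1 := by
    have h := hpow (p ^ r) (x i)
    rw [← hcard, pow_card_eq_one', map_one, Module.End.one_apply] at h
    simpa [hcard] using h.symm
  have h0 : (c - 1) ^ p ^ r = 0 := by rw [sub_pow_char_pow, hc1, one_pow, sub_self]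
  rw [hmul, sub_eq_zero.1 (eq_zero_of_pow_eq_zero h0), one_mul]

/-- A terminal variable that comes from one summand does not vanish on its fixed vector. -/
lemma IsTerminal.apply_last_ne_zero {p r : ℕ} [Fact p.Prime] [CharP K p]
    (hcard : Nat.card G = p ^ r) (he : IsJordanBasis ρ σ e)
    {J : Type*} {x : Basis J K (Dual K V)} {t : J} (hx : IsTerminal ρ x t) {i : I}
    (hblock : ∀ i', i' ≠ i → ∀ j : Fin (n i'), x t (e ⟨i', j⟩) = 0)
    {j₀ : Fin (n i)} (hj₀ : j₀.1 + 1 = n i) : x t (e ⟨i, j₀⟩) ≠ 0 := by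
  intro h0
  -- A discrete antiderivative of `x t` along the blocks. Then σ·l - l = x_t, whose `t`-coordinate
  -- is 1, although the invariant coordinate functional must kill it.
  let l : Dual K V := e.constr K fun s : Σ i, Fin (n i) =>
    if 0 < s.2.1 then x t (e ⟨s.1, ⟨s.2.1 - 1, by omega⟩⟩) else 0
  have hl : ρ.dual σ l = l + x t := by
    refine e.ext ?_
    rintro ⟨i', j⟩
    change l (ρ σ⁻¹ (e ⟨i', j⟩)) = l (e ⟨i', j⟩) + x t (e ⟨i', j⟩)
    rw [he, map_add, add_right_inj]
    split_ifs with h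
    · simp [l]
    · rw [map_zero]
      by_cases hi : i' = i
      · subst hi
        have : j = j₀ := Fin.ext (by omega)
        rw [this, h0]
      · exact (hblock i' hi j).symm
  have h := hx.coord_dual hcard σ l
  rw [hl, map_add, Basis.coord_apply, Basis.coord_apply, Basis.repr_self, Finsupp.single_eq_same,
    add_eq_left] at h
  exact one_ne_zero h

end JordanBlocks

end CyclicCoinvariants

/-! ### Assembly -/

theorem mainTheorem7 {p r : ℕ} [Fact p.Prime] {K : Type*} [Field K] [CharP K p]
    {G : Type*} [Group G] (hcard : Nat.card G = p ^ r)
    (σ : G) (hσ : ∀ g : G, g ∈ Subgroup.zpowers σ)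
    {V : Type*} [AddCommGroup V] [Module K V] (ρ : Representation K G V)
    {k : ℕ} (n : Fin (k + 1) → ℕ) (hn : ∀ i, 1 ≤ n i)
    (e : Module.Basis (Σ i, Fin (n i)) K V) (he : CyclicCoinvariants.IsJordanBasis ρ σ e)
    {I : Type*} (x : Module.Basis I K (Module.Dual K V)) (τ : Fin (k + 1) → I)
    (hblock : ∀ i i' : Fin (k + 1), i' ≠ i → ∀ j : Fin (n i'), x (τ i) (e ⟨i', j⟩) = 0)
    (hterm : ∀ i, CyclicCoinvariants.IsTerminal ρ x (τ i))
    (a : Fin (k + 1) → ℕ)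
    (ha : ∀ i, IsGreatest {m : ℤ | (p : ℚ) ^ (m - 1) < (n i : ℚ)} (a i : ℤ)) :
    (∃ φ : CyclicCoinvariants.linSubalgebra ρ (fun i => x (τ i)) ≃ₐ[K]
        MvPolynomial (Fin (k + 1)) K ⧸
          Ideal.span (Set.range fun i : Fin (k + 1) =>
            (MvPolynomial.X i : MvPolynomial (Fin (k + 1)) K) ^ p ^ a i),
      ∀ i, φ (CyclicCoinvariants.linGen ρ (fun i => x (τ i)) i) =
        Ideal.Quotient.mk _ (MvPolynomial.X i)) ∧
    Module.Free (CyclicCoinvariants.linSubalgebra ρ (fun i => x (τ i)))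
      (CyclicCoinvariants.Coinv ρ) := by
  have hp : p.Prime := Fact.out
  have hfin : Finite G := Nat.finite_of_card_ne_zero (hcard ▸ pow_ne_zero r hp.ne_zero)
  have hlt : ∀ i, ∀ b < a i, p ^ b < n i := by
    intro i b hb
    have h1 : (p : ℚ) ^ ((a i : ℤ) - 1) < n i := (ha i).1
    have h2 : (p : ℚ) ^ (b : ℤ) ≤ (p : ℚ) ^ ((a i : ℤ) - 1) :=
      zpow_le_zpow_right₀ (by exact_mod_cast hp.one_le) (by omega)
    have h3 := h2.trans_lt h1
    rw [zpow_natCast] at h3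
    exact_mod_cast h3
  have hle : ∀ i, n i ≤ p ^ a i := by
    intro i
    by_contra h
    have h1 : ((a i : ℤ) + 1) ∈ {m : ℤ | (p : ℚ) ^ (m - 1) < (n i : ℚ)} := by
      change (p : ℚ) ^ ((a i : ℤ) + 1 - 1) < n i
      rw [add_sub_cancel_right, zpow_natCast]
      exact_mod_cast not_le.1 h
    have := (ha i).2 h1
    omega
  let last : ∀ i, Fin (n i) := fun i => ⟨n i - 1, Nat.sub_lt (hn i) one_pos⟩
  have hlast : ∀ i, (last i).1 + 1 = n i := fun i => Nat.sub_add_cancel (hn i)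
  have hne : ∀ i, x (τ i) (e ⟨i, last i⟩) ≠ 0 := fun i =>
    (hterm i).apply_last_ne_zero hcard he (hblock i) (hlast i)
  let v : Fin (k + 1) → V := fun i => (x (τ i) (e ⟨i, last i⟩))⁻¹ • e ⟨i, last i⟩
  have hvσ : ∀ i, ρ σ⁻¹ (v i) = v i := by
    intro i
    simp only [v, map_smul]
    rw [he, dif_neg (by have := hlast i; omega), add_zero]
  have hv : ∀ h i, ρ h (v i) = v i := by
    intro h i
    have h1 : h ∈ Subgroup.zpowers σ⁻¹ := by
      rw [Subgroup.zpowers_inv]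
      exact hσ h
    rw [← (isOfFinOrder_of_finite σ⁻¹).mem_powers_iff_mem_zpowers] at h1
    obtain ⟨m, rfl⟩ := h1
    simp only [map_pow]
    induction m with
    | zero => simp
    | succ m ih => rw [pow_succ, Module.End.mul_apply, hvσ, ih]
  have hw : ∀ i, ∀ b < a i, ∃ w, (ρ σ⁻¹ ^ p ^ b) w = w + v i := by
    intro i b hb
    have h1 := hlt i b hb
    -- The vector p^b places before the end of the block, with the scaling of `v i`.
    refine ⟨(x (τ i) (e ⟨i, last i⟩))⁻¹ • e ⟨i, ⟨n i - 1 - p ^ b, by omega⟩⟩, ?_⟩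
    rw [map_smul, he.pow_apply, dif_pos (by simp only; omega), smul_add]
    congr 4
    exact Fin.ext (by simp only [last]; omega)
  refine CyclicCoinvariants.linSubalgebra_structure (v := v) (fun i => ?_) (fun i j hij => ?_)
    (fun i => ?_) hv ?_
  · simp only [v, map_smul, smul_eq_mul]
    exact inv_mul_cancel₀ (hne i)
  · simp only [v, map_smul]
    rw [hblock i j hij.symm, smul_zero]
  · refine CyclicCoinvariants.linImage_pow_eq_zero (g := ρ σ⁻¹) (fun f hf h =>
        CyclicCoinvariants.polyAct_eq_self_of_generator hσ hf h)
      (pow_pos hp.pos _) (e.ext ?_)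
    rintro ⟨i', j⟩
    rw [LinearMap.comp_apply, he.pow_apply, map_add, add_eq_left]
    -- A move by p^{a_i} places stays inside a block only if that block is longer than block i, and
    -- on other blocks `x (τ i)` vanishes.
    split_ifs with h
    · refine hblock i i' ?_ _
      rintro rfl
      have := hle i'
      omega
    · exact map_zero _
  · intro f hf m hm hmq
    obtain ⟨i, hi⟩ := Finsupp.ne_iff.1 hm
    exact CyclicCoinvariants.coeff_pullback_eq_zero (p := p) hvσ hw (hf σ) (i := i)
      fun h => hi (Nat.eq_zero_of_dvd_of_lt h (hmq i))
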